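/- Let $m,n\ge 1$ be integers, let $\Bbbk$ be a field, $S=\Bbbk[X_1,\dots,X_m,Y_1,\dots,Y_n]$ and $\mathfrak m=(X_1,\dots,X_m,Y_1,\dots,Y_n)$. Let $\lambda$ be a vertex-weighting of the complete bipartite graph $K_{m,n}$ with partite sets $\{X_1,\dots,X_m\}$ and $\{Y_1,\dots,Y_n\}$, i.e., a function assigning a positive integer to each vertex, and let $$I({}^\lambda K_{m,n})=\bigl(X_i^{\lambda(X_i)}Y_j^{\lambda(Y_j)}\;:\;1\le i\le m,\ 1\le j\le n\bigr)\subseteq S .$$ Let $V_{m,n}$ be Visscher's complex: its faces are the empty face, of dimension $-1$, and the pairs $(A,B)$ with $\emptyset\ne A\subseteq[m]$, $\emptyset\ne B\subseteq[n]$, of dimension $|A|+|B|-2$, ordered by componentwise inclusion. Its geometric realization is the product $\Delta^{m-1}\times\Delta^{n-1}$ of standard simplices, the open cell of $(A,B)$ being the set of points $(x,y)$ with $\{i: x_i\neq 0\}=A$ and $\{j: y_j\ne0\}=B$. Let ${}^\lambda V_{m,n}$ be $V_{m,n}$ with the vertex $(\{i\},\{j\})$ labelled by $X_i^{\lambda(X_i)}Y_j^{\lambda(Y_j)}$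 and every face $E$ labelled by the least common multiple $\ell(E)$ of the labels of its vertices (so $\ell(\emptyset)=1$). An incidence function on $V_{m,n}$ assigns to each pair of faces $(E,E')$ with $\dim E'=\dim E-1$ a value $\epsilon(E,E')\in\{0,1,-1\}$ such that: $\epsilon(E,E')\neq0$ if and only if $E'$ is a face of $E$; $\epsilon(v,\emptyset)=1$ for each vertex $v$; and $\epsilon(E,E')\epsilon(E',G)+\epsilon(E,E'')\epsilon(E'',G)=0$ whenever $E'\ne E''$ are codimension-one faces of $E$ and $G$ is a codimension-two face of $E$ that is a face of both $E'$ and $E''$. For an incidence function $\epsilon$, let $F$ be the sequence in which $F_d$ ($d\ge0$) is the free $S$-module on the faces of dimension $d-1$, with differential $\partial(E)=\sum_{\dim E'=\dim E-1}\epsilon(E,E')\,\frac{\ell(E)}{\ell(E')}\,E'$. Then: 1. The geometric realization of $V_{m,n}$, with the open cells above, is a finite regular cell complex with face poset and dimensions as described. 2. The following signs form an incidence function on $V_{m,n}$: for $A=\{a_1<\dots<a_s\}$ and $B=\{b_1<\dots<b_t\}$ put $\epsilon\bigl((A,B),(A\setminus\{a_i\},B)\bigr)=(-1)^{i-1}$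 if $s\ge2$, $\epsilon\bigl((A,B),(A,B\setminus\{b_j\})\bigr)=(-1)^{s+j-1}$ if $t\ge2$, $\epsilon(v,\emptyset)=1$ for each vertex $v$, and $\epsilon=0$ otherwise. 3. For every incidence function on $V_{m,n}$ (in particular the one in 2), the labelled complex ${}^\lambda V_{m,n}$ supports a minimal free resolution of $S/I({}^\lambda K_{m,n})$: the sequence $\cdots\to F_2\to F_1\to F_0\to S/I({}^\lambda K_{m,n})\to0$ is exact, where the last map sends the basis vector $\emptyset$ of $F_0\cong S$ to $1$; each $F_d$ is free of finite rank; and $\partial(F_{d+1})\subseteq\mathfrak m F_d$ for all $d\ge0$. -/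

import Mathlib

/-! ### Finite regular cell complexes and labelled cellular chain complexes -/

/-- The family `cell` of subsets of `X`, indexed by a finite poset `ι`, is the family of open cells
of a finite regular cell complex with face poset `ι`, the cell `E` having dimension `dim E`.
The empty set is a cell, the only one of dimension `-1`; every other open cell is the interior of a
closed ball embedded as the closure of the cell, that closure is the union of the faces of the
cell, and the faces of a cell are the cells contained in its closure. -/
structure IsFiniteRegularCellComplex {ι : Type*} [Finite ι] [PartialOrder ι]
    {X : Type*} [TopologicalSpace X] (dim : ι → ℤ) (cell : ι → Set X) : Prop where
  nonempty : Nonempty X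
  t2 : T2Space X
  cover : ⋃ E, cell E = Set.univ
  disjoint : ∀ E E', E ≠ E' → Disjoint (cell E) (cell E')
  existsUnique_empty : ∃! E, dim E = -1
  empty_iff : ∀ E, cell E = ∅ ↔ dim E = -1
  ball : ∀ E, dim E ≠ -1 → ∃ d : ℕ, dim E = d ∧
    ∃ φ : Metric.closedBall (0 : EuclideanSpace ℝ (Fin d)) 1 ≃ₜ closure (cell E),
      ∀ x, (φ x : X) ∈ cell E ↔ ‖(x : EuclideanSpace ℝ (Fin d))‖ < 1
  closure_eq : ∀ E, closure (cell E) = ⋃ E' : {E' : ι // E' ≤ E}, cell E'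
  face_iff : ∀ E E', E' ≤ E ↔ cell E' ⊆ closure (cell E)
  dim_lt : ∀ E E', E' < E → dim E' < dim E

/-- Incidence functions. Only the values at pairs with `dim E' = dim E - 1` matter. -/
structure IsIncidenceFunction {ι : Type*} [PartialOrder ι] (dim : ι → ℤ) (ε : ι → ι → ℤ) :
    Prop where
  values : ∀ E E', dim E' = dim E - 1 → ε E E' = 0 ∨ ε E E' = 1 ∨ ε E E' = -1
  ne_zero_iff : ∀ E E', dim E' = dim E - 1 → (ε E E' ≠ 0 ↔ E' ≤ E)
  vertex : ∀ E E₀, dim E = 0 → dim E₀ = -1 → ε E E₀ = 1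
  cancel : ∀ E E' E'' G, E' ≠ E'' → dim E' = dim E - 1 → dim E'' = dim E - 1 →
    dim G = dim E - 2 → E' ≤ E → E'' ≤ E → G ≤ E' → G ≤ E'' →
    ε E E' * ε E' G + ε E E'' * ε E'' G = 0

open Classical in
/-- The label of the cell `E`, when the vertices (cells of dimension `0`) are labelled by the
monomials with exponent vectors `f`: the least common multiple of the labels of the vertices of
`E`, written as an exponent vector (so the lcm is the pointwise supremum). -/
noncomputable def cellLabel {ι : Type*} [Fintype ι] [PartialOrder ι] {σ : Type*} (dim : ι → ℤ)
    (f : {v : ι // dim v = 0} → (σ →₀ ℕ)) (E : ι) : σ →₀ ℕ :=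
  (Finset.univ.filter (fun v : {v : ι // dim v = 0} => (v : ι) ≤ E)).sup f

/-- The module in homological degree `d` of the cellular chain complex over `S`: the free
`S`-module on the cells of dimension `d - 1`. -/
abbrev CellularModule {ι : Type*} (S : Type*) [CommRing S] (dim : ι → ℤ) (d : ℕ) :=
  {E : ι // dim E = (d : ℤ) - 1} →₀ S

/-- The differential of the labelled cellular chain complex, from degree `d + 1` to degree `d`:
the basis vector `E` goes to `∑ ε(E,E') (ℓ(E)/ℓ(E')) E'`, summed over the cells `E'` of dimension
`dim E - 1`. The quotient of monomials is the difference of exponent vectors; whenever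
`ε(E,E') ≠ 0`, the cell `E'` is a face of `E`, so that `ℓ(E')` divides `ℓ(E)`. -/
noncomputable def cellularDifferential {ι : Type*} [Fintype ι] [PartialOrder ι] {σ : Type*}
    (k : Type*) [Field k] (dim : ι → ℤ) (ε : ι → ι → ℤ)
    (f : {v : ι // dim v = 0} → (σ →₀ ℕ)) (d : ℕ) :
    CellularModule (MvPolynomial σ k) dim (d + 1) →ₗ[MvPolynomial σ k]
      CellularModule (MvPolynomial σ k) dim d :=
  Finsupp.linearCombination (MvPolynomial σ k) fun E =>
    ∑ E' : {E' : ι // dim E' = (d : ℤ) - 1},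
      Finsupp.single E' (MvPolynomial.monomial
        (cellLabel dim f (E : ι) - cellLabel dim f (E' : ι)) ((ε E E' : ℤ) : k))

/-- The augmentation from degree `0`, the free module on the empty cell, to `S ⧸ I`: it sends the
basis vector to the class of `1`. -/
noncomputable def cellularAugmentation {ι : Type*} {S : Type*} [CommRing S] (dim : ι → ℤ)
    (I : Ideal S) : CellularModule S dim 0 →ₗ[S] (S ⧸ I) :=
  Finsupp.linearCombination S fun _ => (1 : S ⧸ I)

/-- The sequence `⋯ → F 2 → F 1 → F 0 → M → 0` is a resolution of `M` by finitely generated free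
modules that is minimal with respect to the ideal `𝔪`. -/
structure IsMinimalFreeResolution {S : Type*} [CommRing S] (𝔪 : Ideal S) (F : ℕ → Type*)
    [∀ i, AddCommGroup (F i)] [∀ i, Module S (F i)] (d : ∀ i, F (i + 1) →ₗ[S] F i)
    {M : Type*} [AddCommGroup M] [Module S M] (aug : F 0 →ₗ[S] M) : Prop where
  free : ∀ i, Module.Free S (F i)
  finite : ∀ i, Module.Finite S (F i)
  surjective : Function.Surjective aug
  exact_zero : Function.Exact (d 0) aug
  exact_succ : ∀ i, Function.Exact (d (i + 1)) (d i)
  minimal : ∀ i, LinearMap.range (d i) ≤ 𝔪 • (⊤ : Submodule S (F i))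

/-! ### Edge ideals of vertex-weighted graphs -/

/-- The edge ideal of the vertex-weighted graph `G` with vertex weights `lam`. -/
noncomputable def weightedEdgeIdeal (k : Type*) [Field k] {V : Type*} (G : SimpleGraph V)
    (lam : V → ℕ) : Ideal (MvPolynomial V k) :=
  Ideal.span {p | ∃ v w, G.Adj v w ∧ p = MvPolynomial.X v ^ lam v * MvPolynomial.X w ^ lam w}

/-! ### The complex of Visscher -/

/-- The faces of the complex: the pairs `(A, B)` with `A ⊆ [m]` and `B ⊆ [n]` both nonempty, and
the empty face, written `(∅, ∅)`. The order is componentwise inclusion. -/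
abbrev VisscherFace (m n : ℕ) :=
  {p : Finset (Fin m) × Finset (Fin n) // p.1 = ∅ ↔ p.2 = ∅}

/-- A nonempty face `(A, B)` has dimension `|A| + |B| - 2`, so that vertices have dimension `0`. -/
def visscherDim {m n : ℕ} (E : VisscherFace m n) : ℤ :=
  if E.1.1 = ∅ then -1 else (E.1.1.card : ℤ) + (E.1.2.card : ℤ) - 2

/-- The geometric realization of the complex: a product of two standard simplices. -/
abbrev VisscherSpace (m n : ℕ) := stdSimplex ℝ (Fin m) × stdSimplex ℝ (Fin n)

/-- The open cell of the face `(A, B)`: the product of the open face of the first simplex spanned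
by `A` and the open face of the second simplex spanned by `B`. -/
def visscherCell {m n : ℕ} (E : VisscherFace m n) : Set (VisscherSpace m n) :=
  {p | (∀ i, p.1.1 i ≠ 0 ↔ i ∈ E.1.1) ∧ (∀ j, p.2.1 j ≠ 0 ↔ j ∈ E.1.2)}

/-- The vertex `(i, j)`, that is, the face `({i}, {j})`. -/
def visscherVertex {m n : ℕ} (q : Fin m × Fin n) :
    {v : VisscherFace m n // visscherDim v = 0} :=
  ⟨⟨({q.1}, {q.2}), by simp⟩, by simp [visscherDim]⟩

theorem visscherVertex_bijective {m n : ℕ} :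
    Function.Bijective (visscherVertex : Fin m × Fin n → _) := by
  constructor
  · rintro ⟨i, j⟩ ⟨i', j'⟩ h
    simpa [visscherVertex, Subtype.ext_iff] using h
  · rintro ⟨⟨⟨A, B⟩, hAB⟩, hd⟩
    have hA : A ≠ ∅ := by
      intro h
      simp [visscherDim, h] at hd
    have hB : B ≠ ∅ := fun h => hA (hAB.2 h)
    have h1 := Finset.card_pos.2 (Finset.nonempty_iff_ne_empty.2 hA)
    have h2 := Finset.card_pos.2 (Finset.nonempty_iff_ne_empty.2 hB)
    simp only [visscherDim, hA, if_false] at hd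
    obtain ⟨i, rfl⟩ := Finset.card_eq_one.1 (show A.card = 1 by omega)
    obtain ⟨j, rfl⟩ := Finset.card_eq_one.1 (show B.card = 1 by omega)
    exact ⟨(i, j), rfl⟩

/-- The pairs `(i, j)` enumerate the vertices of the complex. -/
noncomputable def visscherVertexEquiv (m n : ℕ) :
    Fin m × Fin n ≃ {v : VisscherFace m n // visscherDim v = 0} :=
  Equiv.ofBijective visscherVertex visscherVertex_bijective

/-- The labelling of the vertices: `(i, j)` gets `X_i ^ lam (X_i) * Y_j ^ lam (Y_j)`, written as an
exponent vector. The variables are `X_i = Sum.inl i` and `Y_j = Sum.inr j`. -/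
noncomputable def visscherVertexLabel {m n : ℕ} (lam : Fin m ⊕ Fin n → ℕ)
    (v : {v : VisscherFace m n // visscherDim v = 0}) : (Fin m ⊕ Fin n) →₀ ℕ :=
  Finsupp.single (Sum.inl ((visscherVertexEquiv m n).symm v).1)
      (lam (Sum.inl ((visscherVertexEquiv m n).symm v).1)) +
    Finsupp.single (Sum.inr ((visscherVertexEquiv m n).symm v).2)
      (lam (Sum.inr ((visscherVertexEquiv m n).symm v).2))

/-- The signs of the complex. For `A = {a_1 < ⋯ < a_s}` and `B = {b_1 < ⋯ < b_t}`, the face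
`(A - a_i, B)` of `(A, B)` gets the sign `(-1)^(i-1)` and the face `(A, B - b_j)` the sign
`(-1)^(s+j-1)`; the empty face gets the sign `1` in each vertex. -/
def visscherSign {m n : ℕ} (E E' : VisscherFace m n) : ℤ :=
  if E'.1.1 = ∅ then (if visscherDim E = 0 then 1 else 0)
  else
    (∑ a ∈ E.1.1, if E'.1.1 = E.1.1.erase a ∧ E'.1.2 = E.1.2 then
      (-1) ^ (E.1.1.filter (fun x => x < a)).card else 0) +
    (∑ b ∈ E.1.2, if E'.1.1 = E.1.1 ∧ E'.1.2 = E.1.2.erase b then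
      (-1) ^ (E.1.1.card + (E.1.2.filter (fun y => y < b)).card) else 0)

/-!
The open cell of `(A, B)` is the product of an open face of each simplex, so its closure is a
product of two closed faces. Dropping one barycentric coordinate of each factor turns that product
into a convex body of dimension `|A| + |B| - 2`, and a convex body is a closed ball by radial
rescaling (`exists_homeomorph_closure_visscherCell`).

Writing a nonempty face `(A, B)` as the subset `A ⊔ B` of the vertices of the graph, each `X_i`
preceding each `Y_j`, its nonempty facets are obtained by deleting one vertex and the given signs
are those of a simplex (`visscherSign_of_support_eq_erase`), for which the cancellation rule is the
usual one. Only the pairs of end points of an edge, seen from the empty face, need a separate look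
(`VisscherFace.exists_endpoints`). Between a face and a face of codimension two there are exactly
two faces (`VisscherFace.exists_diamond`), so every incidence function gives a complex.

The labelled complex is multigraded. Its strand in multidegree `u` is the augmented chain complex
over `k` of the subcomplex of the cells whose label divides `x ^ u`, and exactness may be checked on
strands (`cellularDifferential_exact`). Here the label of `(A, B)` is the product of the
`c ^ lam c` over `c ∈ A ⊔ B`, so that the subcomplex consists of the faces on the vertices `c` with
`lam c ≤ u c`: it is a product of two simplices, or only the empty face, and then it has no
homology in nonnegative dimensions.

Acyclicity is needed for every incidence function, so the argument must not depend on the signs. Fix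
`a` and `b` among the vertices of the two simplices and match the faces in pairs of codimension one:
`(A, B)` with `(A \ {a}, B)` if `A \ {a}` is not empty, the remaining `({a}, B)` with
`({a}, B \ {b})` if `B \ {b}` is not empty, and `({a}, {b})` with the empty face. The matrix of the
differential on the matched pairs is triangular with `±1` on the diagonal, whatever the signs, which
makes the subcomplex acyclic (`exists_cellBoundary_eq_of_matching`,
`eq_zero_of_forall_cellBoundary_visscherDown_eq_zero`).

In degree `0` the image of the differential is the ideal of the vertex labels, which is the edge
ideal. The complex is minimal because deleting a vertex from a face changes the label, all weights
being positive (`cellLabel_visscher_ne`).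
-/

/-! ### Faces of a standard simplex -/

section SimplexFaces

variable {ι : Type*} [Fintype ι]

/-- The open face of the standard simplex spanned by `A`. -/
def simplexOpenFace (A : Finset ι) : Set (stdSimplex ℝ ι) :=
  {x | ∀ i, x.1 i ≠ 0 ↔ i ∈ A}

/-- The closed face of the standard simplex spanned by `A`. -/
def simplexClosedFace (A : Finset ι) : Set (stdSimplex ℝ ι) :=
  {x | ∀ i, x.1 i ≠ 0 → i ∈ A}

theorem isClosed_simplexClosedFace (A : Finset ι) : IsClosed (simplexClosedFace A) := by
  have h : simplexClosedFace A = ⋂ i : ι, {x : stdSimplex ℝ ι | i ∉ A → x.1 i = 0} := by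
    ext x
    simp only [simplexClosedFace, Set.mem_ofPred_eq, Set.mem_iInter]
    exact forall_congr' fun i => by tauto
  rw [h]
  refine isClosed_iInter fun i => ?_
  by_cases hi : i ∈ A
  · simp [hi]
  · simp only [hi, not_false_eq_true, forall_const]
    exact isClosed_eq ((continuous_apply i).comp continuous_subtype_val) continuous_const

theorem exists_apply_ne_zero_of_stdSimplex (x : stdSimplex ℝ ι) : ∃ i, x.1 i ≠ 0 := by
  by_contra! h
  have := x.2.2
  simp [h] at this

theorem simplexOpenFace_nonempty {A : Finset ι} (hA : A.Nonempty) :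
    (simplexOpenFace A).Nonempty := by
  classical
  have hc : (A.card : ℝ) ≠ 0 := by exact_mod_cast hA.card_pos.ne'
  refine ⟨⟨fun i => if i ∈ A then (A.card : ℝ)⁻¹ else 0, fun i => ?_, ?_⟩, fun i => ?_⟩
  · dsimp only
    split_ifs <;> positivity
  · simp [Finset.sum_ite_mem, hc]
  · simp [hc]

theorem closure_simplexOpenFace {A : Finset ι} (hA : A.Nonempty) :
    closure (simplexOpenFace A) = simplexClosedFace A := by
  refine Set.Subset.antisymm (closure_minimal (fun x hx i => (hx i).1)
    (isClosed_simplexClosedFace A)) fun x hx => ?_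
  obtain ⟨b, hb⟩ := simplexOpenFace_nonempty hA
  -- The open segment from `x` to a point `b` of the open face lies in the open face.
  let γ : ℕ → stdSimplex ℝ ι := fun n =>
    ⟨(1 - (1 / ((n : ℝ) + 1))) • x.1 + (1 / ((n : ℝ) + 1)) • b.1, by
      refine convex_stdSimplex ℝ ι x.2 b.2 ?_ (by positivity) (by ring)
      rw [sub_nonneg, div_le_one (by positivity)]
      linarith [n.cast_nonneg (α := ℝ)]⟩
  have hlim : Filter.Tendsto γ Filter.atTop (nhds x) := by
    rw [tendsto_subtype_rng]
    have h1 := tendsto_one_div_add_atTop_nhds_zero_nat (𝕜 := ℝ)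
    have h2 := ((h1.const_sub 1).smul_const x.1).add (h1.smul_const b.1)
    rw [sub_zero, one_smul, zero_smul, add_zero] at h2
    exact h2
  refine mem_closure_of_tendsto hlim (Filter.Eventually.of_forall fun n i => ?_)
  have hn : (0 : ℝ) < 1 / ((n : ℝ) + 1) := by positivity
  have hn' : 0 ≤ 1 - (1 : ℝ) / ((n : ℝ) + 1) := by
    rw [sub_nonneg, div_le_one (by positivity)]
    linarith [n.cast_nonneg (α := ℝ)]
  change (1 - (1 / ((n : ℝ) + 1))) * x.1 i + (1 / ((n : ℝ) + 1)) * b.1 i ≠ 0 ↔ i ∈ A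
  by_cases hi : i ∈ A
  · have hbi : 0 < b.1 i := lt_of_le_of_ne (b.2.1 i) (Ne.symm ((hb i).2 hi))
    have := mul_nonneg hn' (x.2.1 i)
    have := mul_pos hn hbi
    simp only [hi, iff_true]
    linarith
  · have hbi : b.1 i = 0 := by_contra fun h => hi ((hb i).1 h)
    have hxi : x.1 i = 0 := by_contra fun h => hi (hx i h)
    simp [hi, hbi, hxi]

/-- The full-dimensional simplex in `ℝ ^ ι` with vertices the origin and the unit vectors. -/
def cornerSimplex (ι : Type*) [Fintype ι] : Set (ι → ℝ) :=
  {y | (∀ j, 0 ≤ y j) ∧ ∑ j, y j ≤ 1}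

theorem convex_cornerSimplex : Convex ℝ (cornerSimplex ι) := by
  intro x hx y hy a b ha hb hab
  refine ⟨fun j => ?_, ?_⟩
  · have := mul_nonneg ha (hx.1 j)
    have := mul_nonneg hb (hy.1 j)
    simp only [Pi.add_apply, Pi.smul_apply, smul_eq_mul]
    linarith
  · simp only [Pi.add_apply, Pi.smul_apply, smul_eq_mul, Finset.sum_add_distrib,
      ← Finset.mul_sum]
    have := mul_le_mul_of_nonneg_left hx.2 ha
    have := mul_le_mul_of_nonneg_left hy.2 hb
    linarith

theorem isClosed_cornerSimplex : IsClosed (cornerSimplex ι) := by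
  simp only [cornerSimplex, Set.ofPred_and, Set.ofPred_forall]
  exact (isClosed_iInter fun j => isClosed_le continuous_const (continuous_apply j)).inter
    (isClosed_le (by fun_prop) continuous_const)

theorem isBounded_cornerSimplex : Bornology.IsBounded (cornerSimplex ι) := by
  refine (Metric.isBounded_Icc (0 : ι → ℝ) 1).subset fun y hy => ⟨hy.1, fun j => ?_⟩
  exact (Finset.single_le_sum (fun i _ => hy.1 i) (Finset.mem_univ j)).trans hy.2

theorem interior_cornerSimplex :
    interior (cornerSimplex ι) = {y | (∀ j, 0 < y j) ∧ ∑ j, y j < 1} := by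
  refine Set.Subset.antisymm (fun x hx => ?_) (interior_maximal
    (fun y hy => ⟨fun j => (hy.1 j).le, hy.2.le⟩) ?_)
  · -- A segment from the point `c` with all inequalities strict to an interior point `x` can be
    -- prolonged beyond `x` inside the simplex.
    let c : ι → ℝ := fun _ => 1 / ((Fintype.card ι : ℝ) + 1)
    have hc : ∀ j, 0 < c j := fun j => by positivity
    have hcs : ∑ j, c j < 1 := by
      simp only [c, Finset.sum_const, Finset.card_univ, nsmul_eq_mul, mul_one_div]
      rw [div_lt_one (by positivity)]
      linarith
    have hlim : Filter.Tendsto (fun t : ℝ => x + t • (x - c)) (nhdsWithin 0 (Set.Ioi 0))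
        (nhds x) := by
      have : Continuous fun t : ℝ => x + t • (x - c) := by fun_prop
      simpa using (this.tendsto 0).mono_left nhdsWithin_le_nhds
    obtain ⟨t, ht, ht0⟩ := ((hlim.eventually (mem_interior_iff_mem_nhds.1 hx)).and
      self_mem_nhdsWithin).exists
    have ht0 : 0 < t := ht0
    refine ⟨fun j => ?_, ?_⟩
    · have h1 : 0 ≤ x j + t * (x j - c j) := ht.1 j
      have := mul_pos ht0 (hc j)
      nlinarith
    · have h1 : ∑ j, (x j + t * (x j - c j)) ≤ 1 := ht.2
      rw [Finset.sum_add_distrib, ← Finset.mul_sum, Finset.sum_sub_distrib] at h1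
      have := mul_lt_mul_of_pos_left hcs ht0
      nlinarith
  · simp only [Set.ofPred_and, Set.ofPred_forall]
    exact (isOpen_iInter_of_finite fun j => isOpen_lt continuous_const (continuous_apply j)).inter
      (isOpen_lt (by fun_prop) continuous_const)

theorem interior_cornerSimplex_nonempty : (interior (cornerSimplex ι)).Nonempty := by
  rw [interior_cornerSimplex]
  refine ⟨fun _ => 1 / ((Fintype.card ι : ℝ) + 1), fun j => by positivity, ?_⟩
  simp only [Finset.sum_const, Finset.card_univ, nsmul_eq_mul, mul_one_div]
  rw [div_lt_one (by positivity)]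
  linarith

theorem sum_eq_add_sum_erase_of_support [DecidableEq ι] {A : Finset ι} {a : ι} (ha : a ∈ A)
    {f : ι → ℝ} (hf : ∀ i, f i ≠ 0 → i ∈ A) :
    ∑ i, f i = f a + ∑ j : ↥(A.erase a), f j := by
  rw [Finset.sum_coe_sort (A.erase a) f, Finset.add_sum_erase A f ha]
  exact (Finset.sum_subset (Finset.subset_univ A) fun i _ hi => by_contra fun h => hi (hf i h)).symm

/-- The face spanned by `A`, in the coordinates indexed by `A` without one chosen vertex. -/
theorem exists_homeomorph_simplexClosedFace [DecidableEq ι] {A : Finset ι} {a : ι} (ha : a ∈ A) :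
    ∃ ψ : cornerSimplex ↥(A.erase a) ≃ₜ simplexClosedFace A,
      ∀ y, (ψ y : stdSimplex ℝ ι) ∈ simplexOpenFace A ↔
        (y : ↥(A.erase a) → ℝ) ∈ interior (cornerSimplex ↥(A.erase a)) := by
  let F : (↥(A.erase a) → ℝ) → ι → ℝ := fun y i =>
    if h : i ∈ A.erase a then y ⟨i, h⟩ else if i = a then 1 - ∑ j, y j else 0
  have Fa (y) : F y a = 1 - ∑ j, y j := by simp [F]
  have Fj (y) (j : ↥(A.erase a)) : F y j = y j := by simp [F, -Finset.mem_erase]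
  have Fsupp (y) (i) (h : F y i ≠ 0) : i ∈ A := by
    by_contra hi
    have h1 : i ≠ a := fun h => hi (h ▸ ha)
    exact h (by simp [F, hi, h1])
  have Fsum (y) : ∑ i, F y i = 1 := by
    rw [sum_eq_add_sum_erase_of_support ha (Fsupp y), Fa]
    simp [Fj]
  have Fcases (i) (hi : i ∈ A) : i = a ∨ ∃ j : ↥(A.erase a), i = j := by
    by_cases h : i = a
    · exact Or.inl h
    · exact Or.inr ⟨⟨i, Finset.mem_erase.2 ⟨h, hi⟩⟩, rfl⟩
  have Fnonneg (y) (hy : y ∈ cornerSimplex ↥(A.erase a)) (i) : 0 ≤ F y i := by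
    by_cases hi : i ∈ A
    · rcases Fcases i hi with rfl | ⟨j, rfl⟩
      · rw [Fa]; linarith [hy.2]
      · rw [Fj]; exact hy.1 j
    · exact (not_not.1 (mt (Fsupp y i) hi)).ge
  have Fcont : Continuous F := by
    refine continuous_pi fun i => ?_
    by_cases h : i ∈ A.erase a
    · simp only [F, h, dif_pos]; fun_prop
    · by_cases h' : i = a
      · subst h'; simp only [Fa]; fun_prop
      · simp only [F, h, h', dif_neg, if_neg, not_false_eq_true]; fun_prop
  refine ⟨{ toFun := fun y => ⟨⟨F y, Fnonneg y y.2, Fsum y⟩, Fsupp y⟩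
            invFun := fun x => ⟨fun j => x.1.1 j, fun j => x.1.2.1 j, ?_⟩
            left_inv := fun y => Subtype.ext (funext fun j => Fj y j)
            right_inv := fun x => ?_
            continuous_toFun := ?_
            continuous_invFun := ?_ }, fun y => ?_⟩
  · have h1 := x.1.2.2
    rw [sum_eq_add_sum_erase_of_support ha x.2] at h1
    linarith [x.1.2.1 a]
  · refine Subtype.ext (Subtype.ext (funext fun i => ?_))
    change F (fun j => x.1.1 j) i = x.1.1 i
    by_cases hi : i ∈ A
    · rcases Fcases i hi with rfl | ⟨j, rfl⟩
      · have h1 := x.1.2.2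
        rw [sum_eq_add_sum_erase_of_support ha x.2] at h1
        exact (Fa _).trans (by linarith)
      · exact Fj _ j
    · exact (not_not.1 (mt (Fsupp _ i) hi)).trans (not_not.1 (mt (x.2 i) hi)).symm
  · exact ((Fcont.comp continuous_subtype_val).subtype_mk _).subtype_mk _
  · refine Continuous.subtype_mk (continuous_pi fun j => ?_) _
    exact (continuous_apply (j : ι)).comp (continuous_subtype_val.comp continuous_subtype_val)
  · rw [interior_cornerSimplex]
    change (∀ i, F y i ≠ 0 ↔ i ∈ A) ↔ (∀ j, 0 < y.1 j) ∧ ∑ j, y.1 j < 1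
    constructor
    · refine fun h => ⟨fun j => ?_, ?_⟩
      · have := (h j).2 (Finset.mem_of_mem_erase j.2)
        rw [Fj] at this
        exact lt_of_le_of_ne (y.2.1 j) this.symm
      · have := (h a).2 ha
        rw [Fa] at this
        exact lt_of_le_of_ne y.2.2 fun h => this (by rw [h]; ring)
    · refine fun h i => ⟨Fsupp y i, fun hi => ?_⟩
      rcases Fcases i hi with rfl | ⟨j, rfl⟩
      · rw [Fa]; linarith [h.2]
      · rw [Fj]; exact (h.1 j).ne'

end SimplexFaces

/-- A compact convex body is a closed ball, by a homeomorphism that respects the interiors. -/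
theorem exists_homeomorph_closedBall_of_convex {V : Type*} [NormedAddCommGroup V]
    [NormedSpace ℝ V] [FiniteDimensional ℝ V] {d : ℕ} (hd : Module.finrank ℝ V = d) {K : Set V}
    (hc : Convex ℝ K) (hK : IsClosed K) (hb : Bornology.IsBounded K)
    (hne : (interior K).Nonempty) :
    ∃ φ : Metric.closedBall (0 : EuclideanSpace ℝ (Fin d)) 1 ≃ₜ K,
      ∀ x, (φ x : V) ∈ interior K ↔ ‖(x : EuclideanSpace ℝ (Fin d))‖ < 1 := by
  let L : V ≃L[ℝ] EuclideanSpace ℝ (Fin d) :=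
    ContinuousLinearEquiv.ofFinrankEq (by rw [hd, finrank_euclideanSpace_fin])
  have hLint : L '' interior K = interior (L '' K) := L.toHomeomorph.image_interior K
  obtain ⟨h, h1, h2, -⟩ := exists_homeomorph_image_interior_closure_frontier_eq_unitBall
    (s := L '' K) (hc.linear_image (L : V →ₗ[ℝ] EuclideanSpace ℝ (Fin d)))
    (hLint ▸ hne.image L) (L.toContinuousLinearMap.lipschitz.isBounded_image hb)
  have hcl : closure (L '' K) = L '' K := (L.toHomeomorph.isClosed_image.2 hK).closure_eq
  rw [← hLint] at h1
  rw [hcl] at h2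
  let e : V ≃ₜ EuclideanSpace ℝ (Fin d) := L.toHomeomorph.trans h
  have e1 : e '' interior K = Metric.ball 0 1 := by rw [← h1, Set.image_image]; rfl
  have e2 : e '' K = Metric.closedBall 0 1 := by rw [← h2, Set.image_image]; rfl
  refine ⟨(e.sets (s := K) (t := Metric.closedBall 0 1) ?_).symm, fun x => ?_⟩
  · rw [← e2, e.preimage_image]
  · have : (e.symm x : V) ∈ interior K ↔ (x : EuclideanSpace ℝ (Fin d)) ∈ Metric.ball 0 1 := by
      rw [← e1]
      constructor
      · exact fun hx => ⟨_, hx, e.apply_symm_apply _⟩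
      · rintro ⟨y, hy, hyx⟩
        rw [← hyx, e.symm_apply_apply]
        exact hy
    rw [mem_ball_zero_iff] at this
    exact this

/-! ### The cell structure on a product of two simplices -/

section VisscherCells

variable {m n : ℕ}

theorem VisscherFace.le_iff {E E' : VisscherFace m n} :
    E' ≤ E ↔ E'.1.1 ⊆ E.1.1 ∧ E'.1.2 ⊆ E.1.2 := Iff.rfl

theorem VisscherFace.fst_nonempty_iff_snd {E : VisscherFace m n} :
    E.1.1.Nonempty ↔ E.1.2.Nonempty := by
  rw [Finset.nonempty_iff_ne_empty, Finset.nonempty_iff_ne_empty, Ne, Ne, E.2]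

theorem visscherDim_of_nonempty {E : VisscherFace m n} (hE : E.1.1.Nonempty) :
    visscherDim E = (E.1.1.card : ℤ) + (E.1.2.card : ℤ) - 2 := by
  simp [visscherDim, hE.ne_empty]

theorem visscherDim_nonneg {E : VisscherFace m n} (hE : E.1.1.Nonempty) :
    0 ≤ visscherDim E := by
  have h1 := hE.card_pos
  have h2 := (VisscherFace.fst_nonempty_iff_snd.1 hE).card_pos
  rw [visscherDim_of_nonempty hE]
  omega

theorem visscherDim_eq_neg_one_iff {E : VisscherFace m n} :
    visscherDim E = -1 ↔ E.1.1 = ∅ := by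
  refine ⟨fun h => ?_, fun h => by simp [visscherDim, h]⟩
  by_contra hE
  have := visscherDim_nonneg (Finset.nonempty_iff_ne_empty.2 hE)
  omega

theorem visscherDim_lt {E E' : VisscherFace m n} (h : E' < E) :
    visscherDim E' < visscherDim E := by
  have hle := VisscherFace.le_iff.1 h.le
  have hne : ¬ E ≤ E' := h.not_ge
  by_cases hE' : E'.1.1 = ∅
  · have hE : E.1.1.Nonempty := by
      rw [Finset.nonempty_iff_ne_empty]
      intro hE
      exact hne (VisscherFace.le_iff.2 (by simp [hE, E.2.1 hE]))
    have := visscherDim_nonneg hE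
    rw [visscherDim_eq_neg_one_iff.2 hE']
    omega
  · have hE' := Finset.nonempty_iff_ne_empty.2 hE'
    rw [visscherDim_of_nonempty hE', visscherDim_of_nonempty (hE'.mono hle.1)]
    have h1 := Finset.card_le_card hle.1
    have h2 := Finset.card_le_card hle.2
    by_contra hlt
    refine hne (VisscherFace.le_iff.2 ⟨?_, ?_⟩)
    · exact (Finset.eq_of_subset_of_card_le hle.1 (by omega)).ge
    · exact (Finset.eq_of_subset_of_card_le hle.2 (by omega)).ge

theorem visscherCell_eq_prod (E : VisscherFace m n) :
    visscherCell E = simplexOpenFace E.1.1 ×ˢ simplexOpenFace E.1.2 := rfl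

theorem visscherCell_nonempty {E : VisscherFace m n} (hE : E.1.1.Nonempty) :
    (visscherCell E).Nonempty := by
  rw [visscherCell_eq_prod]
  exact (simplexOpenFace_nonempty hE).prod
    (simplexOpenFace_nonempty (VisscherFace.fst_nonempty_iff_snd.1 hE))

theorem visscherCell_eq_empty {E : VisscherFace m n} (hE : E.1.1 = ∅) :
    visscherCell E = ∅ := by
  refine Set.eq_empty_of_forall_notMem fun p hp => ?_
  obtain ⟨i, hi⟩ := exists_apply_ne_zero_of_stdSimplex p.1
  have := (hp.1 i).1 hi
  simp [hE] at this

theorem closure_visscherCell {E : VisscherFace m n} (hE : E.1.1.Nonempty) :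
    closure (visscherCell E) = simplexClosedFace E.1.1 ×ˢ simplexClosedFace E.1.2 := by
  rw [visscherCell_eq_prod, closure_prod_eq, closure_simplexOpenFace hE,
    closure_simplexOpenFace (VisscherFace.fst_nonempty_iff_snd.1 hE)]

theorem exists_mem_visscherCell (p : VisscherSpace m n) : ∃ E, p ∈ visscherCell E := by
  classical
  obtain ⟨i, hi⟩ := exists_apply_ne_zero_of_stdSimplex p.1
  obtain ⟨j, hj⟩ := exists_apply_ne_zero_of_stdSimplex p.2
  refine ⟨⟨(Finset.univ.filter fun i => p.1.1 i ≠ 0, Finset.univ.filter fun j => p.2.1 j ≠ 0),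
    iff_of_false ?_ ?_⟩, ?_⟩
  · exact Finset.ne_empty_of_mem (a := i) (by simpa using hi)
  · exact Finset.ne_empty_of_mem (a := j) (by simpa using hj)
  · simp [visscherCell]

theorem mem_closure_visscherCell_iff {E : VisscherFace m n} {p : VisscherSpace m n} :
    p ∈ closure (visscherCell E) ↔ ∃ E' ≤ E, p ∈ visscherCell E' := by
  by_cases hE : E.1.1 = ∅
  · rw [visscherCell_eq_empty hE, closure_empty]
    refine ⟨False.elim, ?_⟩
    rintro ⟨E', hle, hp⟩
    rwa [visscherCell_eq_empty (Finset.subset_empty.1 (hle.1.trans hE.le))] at hp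
  · rw [closure_visscherCell (Finset.nonempty_iff_ne_empty.2 hE)]
    constructor
    · rintro ⟨h1, h2⟩
      obtain ⟨E', hE'⟩ := exists_mem_visscherCell p
      exact ⟨E', ⟨fun i hi => h1 i ((hE'.1 i).2 hi), fun j hj => h2 j ((hE'.2 j).2 hj)⟩, hE'⟩
    · rintro ⟨E', hle, hp⟩
      exact ⟨fun i hi => hle.1 ((hp.1 i).1 hi), fun j hj => hle.2 ((hp.2 j).1 hj)⟩

theorem exists_homeomorph_closure_visscherCell {E : VisscherFace m n} (hE : E.1.1.Nonempty) :
    ∃ d : ℕ, visscherDim E = d ∧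
      ∃ φ : Metric.closedBall (0 : EuclideanSpace ℝ (Fin d)) 1 ≃ₜ closure (visscherCell E),
        ∀ x, (φ x : VisscherSpace m n) ∈ visscherCell E ↔
          ‖(x : EuclideanSpace ℝ (Fin d))‖ < 1 := by
  have hE2 := VisscherFace.fst_nonempty_iff_snd.1 hE
  obtain ⟨a, ha⟩ := hE
  obtain ⟨b, hb⟩ := hE2
  have hA := Finset.card_pos.2 ⟨a, ha⟩
  have hB := Finset.card_pos.2 ⟨b, hb⟩
  obtain ⟨ψ, hψ⟩ := exists_homeomorph_simplexClosedFace ha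
  obtain ⟨χ, hχ⟩ := exists_homeomorph_simplexClosedFace hb
  let K := cornerSimplex ↥(E.1.1.erase a) ×ˢ cornerSimplex ↥(E.1.2.erase b)
  have hKint : interior K = interior (cornerSimplex ↥(E.1.1.erase a)) ×ˢ
    interior (cornerSimplex ↥(E.1.2.erase b)) := interior_prod_eq _ _
  have hrank : Module.finrank ℝ ((↥(E.1.1.erase a) → ℝ) × (↥(E.1.2.erase b) → ℝ)) =
      (E.1.1.card - 1) + (E.1.2.card - 1) := by
    rw [Module.finrank_prod, Module.finrank_fintype_fun_eq_card,
      Module.finrank_fintype_fun_eq_card, Fintype.card_coe, Fintype.card_coe,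
      Finset.card_erase_of_mem ha, Finset.card_erase_of_mem hb]
  obtain ⟨φ, hφ⟩ := exists_homeomorph_closedBall_of_convex hrank (K := K)
    (convex_cornerSimplex.prod convex_cornerSimplex)
    (isClosed_cornerSimplex.prod isClosed_cornerSimplex)
    (isBounded_cornerSimplex.prod isBounded_cornerSimplex)
    (hKint ▸ interior_cornerSimplex_nonempty.prod interior_cornerSimplex_nonempty)
  refine ⟨_, ?_, φ.trans ((Homeomorph.Set.prod _ _).trans ((ψ.prodCongr χ).trans
    ((Homeomorph.Set.prod _ _).symm.trans
      (Homeomorph.setCongr (closure_visscherCell ⟨a, ha⟩).symm)))), fun x => ?_⟩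
  · rw [visscherDim_of_nonempty ⟨a, ha⟩]
    omega
  · rw [← hφ x, hKint]
    exact and_congr (hψ _) (hχ _)

theorem isFiniteRegularCellComplex_visscher (hm : 1 ≤ m) (hn : 1 ≤ n) :
    IsFiniteRegularCellComplex (visscherDim (m := m) (n := n)) visscherCell where
  nonempty := by
    have : Nonempty (Fin m) := ⟨⟨0, hm⟩⟩
    have : Nonempty (Fin n) := ⟨⟨0, hn⟩⟩
    infer_instance
  t2 := inferInstance
  cover := Set.eq_univ_of_forall fun p => Set.mem_iUnion.2 (exists_mem_visscherCell p)
  disjoint E E' hne := by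
    refine Set.disjoint_left.2 fun p h h' => hne (Subtype.ext (Prod.ext ?_ ?_))
    · ext i
      rw [← h.1 i, ← h'.1 i]
    · ext j
      rw [← h.2 j, ← h'.2 j]
  existsUnique_empty := by
    refine ⟨⟨(∅, ∅), by simp⟩, visscherDim_eq_neg_one_iff.2 rfl, fun E hE => ?_⟩
    have h := visscherDim_eq_neg_one_iff.1 hE
    exact Subtype.ext (Prod.ext h (E.2.1 h))
  empty_iff E := by
    rw [visscherDim_eq_neg_one_iff]
    refine ⟨fun h => by_contra fun hE => ?_, visscherCell_eq_empty⟩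
    exact (visscherCell_nonempty (Finset.nonempty_iff_ne_empty.2 hE)).ne_empty h
  ball E hE := exists_homeomorph_closure_visscherCell
    (Finset.nonempty_iff_ne_empty.2 (mt visscherDim_eq_neg_one_iff.2 hE))
  closure_eq E := by
    ext p
    simp [mem_closure_visscherCell_iff]
  face_iff E E' := by
    refine ⟨fun h p hp => mem_closure_visscherCell_iff.2 ⟨E', h, hp⟩, fun h => ?_⟩
    by_cases hE' : E'.1.1 = ∅
    · exact VisscherFace.le_iff.2 (by simp [hE', E'.2.1 hE'])
    · obtain ⟨p, hp⟩ := visscherCell_nonempty (Finset.nonempty_iff_ne_empty.2 hE')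
      obtain ⟨E'', hle, hp'⟩ := mem_closure_visscherCell_iff.1 (h hp)
      exact VisscherFace.le_iff.2 ⟨fun i hi => hle.1 ((hp'.1 i).1 ((hp.1 i).2 hi)),
        fun j hj => hle.2 ((hp'.2 j).1 ((hp.2 j).2 hj))⟩
  dim_lt _ _ := visscherDim_lt

end VisscherCells

/-! ### The signs form an incidence function -/

section VisscherSigns

variable {m n : ℕ}

/-- The face `(A, B)` as the set `A ⊔ B` of vertices of the complete bipartite graph. -/
def VisscherFace.support (E : VisscherFace m n) : Finset (Fin m ⊕ Fin n) :=
  E.1.1.disjSum E.1.2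

theorem VisscherFace.inl_mem_support {E : VisscherFace m n} {i : Fin m} :
    Sum.inl i ∈ E.support ↔ i ∈ E.1.1 := Finset.inl_mem_disjSum

theorem VisscherFace.inr_mem_support {E : VisscherFace m n} {j : Fin n} :
    Sum.inr j ∈ E.support ↔ j ∈ E.1.2 := Finset.inr_mem_disjSum

theorem VisscherFace.le_iff_support {E E' : VisscherFace m n} :
    E' ≤ E ↔ E'.support ⊆ E.support := by
  constructor
  · rintro ⟨h1, h2⟩ (i | j) h
    · exact inl_mem_support.2 (h1 (inl_mem_support.1 h))
    · exact inr_mem_support.2 (h2 (inr_mem_support.1 h))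
  · exact fun h => ⟨fun i hi => inl_mem_support.1 (h (inl_mem_support.2 hi)),
      fun j hj => inr_mem_support.1 (h (inr_mem_support.2 hj))⟩

theorem VisscherFace.support_injective :
    Function.Injective (VisscherFace.support : VisscherFace m n → _) := fun _ _ h =>
  le_antisymm (le_iff_support.2 h.le) (le_iff_support.2 h.ge)

theorem visscherDim_eq_card_support {E : VisscherFace m n} (hE : E.1.1.Nonempty) :
    visscherDim E = (E.support.card : ℤ) - 2 := by
  rw [visscherDim_of_nonempty hE, VisscherFace.support, Finset.card_disjSum]
  push_cast
  ring

theorem VisscherFace.exists_support_eq {G : VisscherFace m n} (hG : G.1.1.Nonempty)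
    {S : Finset (Fin m ⊕ Fin n)} (hS : G.support ⊆ S) :
    ∃ E : VisscherFace m n, E.1.1.Nonempty ∧ E.support = S := by
  obtain ⟨i, hi⟩ := hG
  obtain ⟨j, hj⟩ := fst_nonempty_iff_snd.1 ⟨i, hi⟩
  have h1 : i ∈ S.toLeft := Finset.mem_toLeft.2 (hS (inl_mem_support.2 hi))
  have h2 : j ∈ S.toRight := Finset.mem_toRight.2 (hS (inr_mem_support.2 hj))
  exact ⟨⟨(S.toLeft, S.toRight), iff_of_false (Finset.ne_empty_of_mem h1)
    (Finset.ne_empty_of_mem h2)⟩, ⟨i, h1⟩, Finset.toLeft_disjSum_toRight⟩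

/-- A nonempty face of codimension one is obtained by deleting one vertex of the graph. -/
theorem VisscherFace.exists_support_eq_erase {E E' : VisscherFace m n} (hE' : E'.1.1.Nonempty)
    (hle : E' ≤ E) (hd : visscherDim E' = visscherDim E - 1) :
    ∃ c ∈ E.support, E'.support = E.support.erase c := by
  rw [visscherDim_eq_card_support hE', visscherDim_eq_card_support (hE'.mono hle.1)] at hd
  obtain ⟨c, hc, h⟩ := Finset.exists_eq_insert_iff.2 ⟨le_iff_support.1 hle, by omega⟩
  exact ⟨c, h ▸ Finset.mem_insert_self _ _, by rw [← h, Finset.erase_insert hc]⟩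

theorem visscherSign_of_fst_eq_erase {E E' : VisscherFace m n} (hE' : E'.1.1.Nonempty)
    {a : Fin m} (ha : a ∈ E.1.1) (h1 : E'.1.1 = E.1.1.erase a) (h2 : E'.1.2 = E.1.2) :
    visscherSign E E' = (-1) ^ (E.1.1.filter fun x => x < a).card := by
  have h3 : ∀ a' ∈ E.1.1, E.1.1.erase a = E.1.1.erase a' → a' = a := fun a' ha' h =>
    Finset.erase_injOn E.1.1 ha' ha h.symm
  rw [visscherSign, if_neg hE'.ne_empty, Finset.sum_eq_single a, if_pos ⟨h1, h2⟩,
    Finset.sum_eq_zero, add_zero]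
  · refine fun b _ => if_neg fun h => ?_
    exact Finset.erase_ne_self.2 ha (h1.symm.trans h.1)
  · exact fun a' ha' hne => if_neg fun h => hne (h3 a' ha' (h1.symm.trans h.1))
  · exact fun h => absurd ha h

theorem visscherSign_of_snd_eq_erase {E E' : VisscherFace m n} (hE' : E'.1.1.Nonempty)
    {b : Fin n} (hb : b ∈ E.1.2) (h1 : E'.1.1 = E.1.1) (h2 : E'.1.2 = E.1.2.erase b) :
    visscherSign E E' = (-1) ^ (E.1.1.card + (E.1.2.filter fun y => y < b).card) := by
  have h3 : ∀ b' ∈ E.1.2, E.1.2.erase b = E.1.2.erase b' → b' = b := fun b' hb' h =>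
    Finset.erase_injOn E.1.2 hb' hb h.symm
  rw [visscherSign, if_neg hE'.ne_empty, Finset.sum_eq_zero, zero_add,
    Finset.sum_eq_single b, if_pos ⟨h1, h2⟩]
  · exact fun b' hb' hne => if_neg fun h => hne (h3 b' hb' (h2.symm.trans h.2))
  · exact fun h => absurd hb h
  · refine fun a _ => if_neg fun h => ?_
    exact Finset.erase_ne_self.2 hb (h2.symm.trans h.2)

/-- On nonempty faces the signs are those of the simplex on all vertices of the graph, each `X_i`
preceding each `Y_j`. -/
theorem visscherSign_of_support_eq_erase {E E' : VisscherFace m n} (hE' : E'.1.1.Nonempty)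
    {c : Fin m ⊕ Fin n} (hc : c ∈ E.support) (h : E'.support = E.support.erase c) :
    visscherSign E E' = (-1) ^ (E.support.filter fun x => toLex x < toLex c).card := by
  have hl (i : Fin m) : i ∈ E'.1.1 ↔ Sum.inl i ≠ c ∧ i ∈ E.1.1 := by
    rw [← VisscherFace.inl_mem_support, h, Finset.mem_erase, VisscherFace.inl_mem_support]
  have hr (j : Fin n) : j ∈ E'.1.2 ↔ Sum.inr j ≠ c ∧ j ∈ E.1.2 := by
    rw [← VisscherFace.inr_mem_support, h, Finset.mem_erase, VisscherFace.inr_mem_support]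
  rcases c with a | b
  · rw [visscherSign_of_fst_eq_erase hE' (VisscherFace.inl_mem_support.1 hc)
      (by ext i; simp [hl]) (by ext j; simp [hr])]
    have : (E.support.filter fun x => toLex x < toLex (Sum.inl a)) =
        (E.1.1.filter fun x => x < a).disjSum ∅ := by
      ext (i | j) <;> simp [VisscherFace.inl_mem_support, VisscherFace.inr_mem_support]
    rw [this, Finset.card_disjSum, Finset.card_empty, add_zero]
  · rw [visscherSign_of_snd_eq_erase hE' (VisscherFace.inr_mem_support.1 hc)
      (by ext i; simp [hl]) (by ext j; simp [hr])]
    have : (E.support.filter fun x => toLex x < toLex (Sum.inr b)) =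
        E.1.1.disjSum (E.1.2.filter fun y => y < b) := by
      ext (i | j) <;> simp [VisscherFace.inl_mem_support, VisscherFace.inr_mem_support]
    rw [this, Finset.card_disjSum]

theorem visscherSign_of_not_le {E E' : VisscherFace m n} (hE' : E'.1.1.Nonempty)
    (h : ¬ E' ≤ E) : visscherSign E E' = 0 := by
  rw [visscherSign, if_neg hE'.ne_empty, Finset.sum_eq_zero, Finset.sum_eq_zero, add_zero]
  · exact fun b _ => if_neg fun hb => h ⟨hb.1.le, hb.2.le.trans (Finset.erase_subset _ _)⟩
  · exact fun a _ => if_neg fun ha => h ⟨ha.1.le.trans (Finset.erase_subset _ _), ha.2.le⟩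

theorem visscherSign_of_eq_empty {E E' : VisscherFace m n} (hE' : E'.1.1 = ∅)
    (hE : visscherDim E = 0) : visscherSign E E' = 1 := by
  rw [visscherSign, if_pos hE', if_pos hE]

/-- Deleting two elements in either order gives opposite products of signs, since the
exponent of the later of the two drops by one when the earlier is deleted first. -/
theorem neg_one_pow_erase_add_neg_one_pow_erase {α β : Type*} [DecidableEq α] [LinearOrder β]
    {p : α → β} (hp : Function.Injective p) {S : Finset α} {c c' : α} (hc : c ∈ S) (hc' : c' ∈ S)
    (hne : c ≠ c') :
    (-1 : ℤ) ^ (S.filter fun x => p x < p c).card *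
        (-1) ^ ((S.erase c).filter fun x => p x < p c').card +
      (-1) ^ (S.filter fun x => p x < p c').card *
        (-1) ^ ((S.erase c').filter fun x => p x < p c).card = 0 := by
  wlog h : p c < p c' generalizing c c'
  · rw [add_comm]
    exact this hc' hc hne.symm (lt_of_le_of_ne (not_lt.1 h) fun he => hne (hp he).symm)
  have h1 : (S.erase c').filter (fun x => p x < p c) = S.filter fun x => p x < p c := by
    rw [Finset.filter_erase, Finset.erase_eq_of_notMem]
    simp [h.le]
  have h2 : ((S.erase c).filter fun x => p x < p c').card + 1 =
      (S.filter fun x => p x < p c').card := by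
    rw [Finset.filter_erase, Finset.card_erase_add_one]
    simp [hc, h]
  rw [h1, ← h2, pow_succ]
  ring

/-- The edges of the complex. -/
theorem VisscherFace.eq_of_dim_eq_one {E : VisscherFace m n} (h : visscherDim E = 1) :
    (∃ i i' j, i < i' ∧ E.1 = ({i, i'}, {j})) ∨ ∃ i j j', j < j' ∧ E.1 = ({i}, {j, j'}) := by
  have hE : E.1.1.Nonempty := by
    rw [Finset.nonempty_iff_ne_empty, Ne, ← visscherDim_eq_neg_one_iff, h]
    decide
  have hE2 := fst_nonempty_iff_snd.1 hE
  rw [visscherDim_of_nonempty hE] at h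
  have h1 := hE.card_pos
  have h2 := hE2.card_pos
  rcases (by omega : E.1.1.card = 2 ∧ E.1.2.card = 1 ∨ E.1.1.card = 1 ∧ E.1.2.card = 2) with
    ⟨hA, hB⟩ | ⟨hA, hB⟩
  · obtain ⟨i, i', hne, hA⟩ := Finset.card_eq_two.1 hA
    obtain ⟨j, hB⟩ := Finset.card_eq_one.1 hB
    rcases hne.lt_or_gt with hlt | hlt
    · exact Or.inl ⟨i, i', j, hlt, Prod.ext hA hB⟩
    · exact Or.inl ⟨i', i, j, hlt, Prod.ext (hA.trans (Finset.pair_comm _ _)) hB⟩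
  · obtain ⟨j, j', hne, hB⟩ := Finset.card_eq_two.1 hB
    obtain ⟨i, hA⟩ := Finset.card_eq_one.1 hA
    rcases hne.lt_or_gt with hlt | hlt
    · exact Or.inr ⟨i, j, j', hlt, Prod.ext hA hB⟩
    · exact Or.inr ⟨i, j', j, hlt, Prod.ext hA (hB.trans (Finset.pair_comm _ _))⟩

/-- An edge has exactly two end points, and they get opposite signs. -/
theorem VisscherFace.exists_endpoints {E : VisscherFace m n} (h : visscherDim E = 1) :
    ∃ v w : VisscherFace m n, v ≠ w ∧ visscherDim v = 0 ∧ visscherDim w = 0 ∧ v ≤ E ∧ w ≤ E ∧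
      (∀ u, visscherDim u = 0 → u ≤ E → u = v ∨ u = w) ∧
      visscherSign E v + visscherSign E w = 0 := by
  obtain ⟨⟨A, B⟩, hAB⟩ := E
  rcases eq_of_dim_eq_one h with ⟨i, i', j, hlt, hE⟩ | ⟨i, j, j', hlt, hE⟩ <;>
    obtain ⟨rfl, rfl⟩ := Prod.ext_iff.1 hE
  · refine ⟨(visscherVertex (i, j)).1, (visscherVertex (i', j)).1, ?_, (visscherVertex _).2,
      (visscherVertex _).2, ?_, ?_, ?_, ?_⟩
    · simp [visscherVertex, hlt.ne]
    · simp [visscherVertex]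
    · simp [visscherVertex]
    · intro u hu hle
      obtain ⟨⟨a, b⟩, hq⟩ := visscherVertex_bijective.2 ⟨u, hu⟩
      obtain rfl : (visscherVertex (a, b)).1 = u := by rw [hq]
      simp only [visscherVertex, Subtype.mk_le_mk, Prod.mk_le_mk,
        Finset.singleton_subset_iff, Finset.mem_insert, Finset.mem_singleton] at hle
      simp only [visscherVertex, Subtype.mk.injEq, Prod.mk.injEq, Finset.singleton_inj]
      tauto
    · have h1 : visscherSign ⟨({i, i'}, {j}), hAB⟩ (visscherVertex (i, j)).1 = _ :=
        visscherSign_of_fst_eq_erase (a := i') (by simp [visscherVertex]) (by simp)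
          (by simp only [visscherVertex]; grind) rfl
      have h2 : visscherSign ⟨({i, i'}, {j}), hAB⟩ (visscherVertex (i', j)).1 = _ :=
        visscherSign_of_fst_eq_erase (a := i) (by simp [visscherVertex]) (by simp)
          (by simp only [visscherVertex]; grind) rfl
      rw [h1, h2]
      simp [Finset.filter_insert, Finset.filter_singleton, hlt, hlt.not_gt]
  · refine ⟨(visscherVertex (i, j)).1, (visscherVertex (i, j')).1, ?_, (visscherVertex _).2,
      (visscherVertex _).2, ?_, ?_, ?_, ?_⟩
    · simp [visscherVertex, hlt.ne]
    · simp [visscherVertex]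
    · simp [visscherVertex]
    · intro u hu hle
      obtain ⟨⟨a, b⟩, hq⟩ := visscherVertex_bijective.2 ⟨u, hu⟩
      obtain rfl : (visscherVertex (a, b)).1 = u := by rw [hq]
      simp only [visscherVertex, Subtype.mk_le_mk, Prod.mk_le_mk,
        Finset.singleton_subset_iff, Finset.mem_insert, Finset.mem_singleton] at hle
      simp only [visscherVertex, Subtype.mk.injEq, Prod.mk.injEq, Finset.singleton_inj]
      tauto
    · have h1 : visscherSign ⟨({i}, {j, j'}), hAB⟩ (visscherVertex (i, j)).1 = _ :=
        visscherSign_of_snd_eq_erase (b := j') (by simp [visscherVertex]) (by simp) rfl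
          (by simp only [visscherVertex]; grind)
      have h2 : visscherSign ⟨({i}, {j, j'}), hAB⟩ (visscherVertex (i, j')).1 = _ :=
        visscherSign_of_snd_eq_erase (b := j) (by simp [visscherVertex]) (by simp) rfl
          (by simp only [visscherVertex]; grind)
      rw [h1, h2]
      simp [Finset.filter_insert, Finset.filter_singleton, hlt, hlt.not_gt]

theorem isIncidenceFunction_visscherSign :
    IsIncidenceFunction (visscherDim (m := m) (n := n)) visscherSign where
  values E E' hd := by
    by_cases hE' : E'.1.1 = ∅
    · rw [visscherDim_eq_neg_one_iff.2 hE'] at hd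
      exact Or.inr (Or.inl (visscherSign_of_eq_empty hE' (by omega)))
    · have hE' := Finset.nonempty_iff_ne_empty.2 hE'
      by_cases hle : E' ≤ E
      · obtain ⟨c, hc, h⟩ := VisscherFace.exists_support_eq_erase hE' hle hd
        rw [visscherSign_of_support_eq_erase hE' hc h]
        exact Or.inr (neg_one_pow_eq_or ℤ _)
      · exact Or.inl (visscherSign_of_not_le hE' hle)
  ne_zero_iff E E' hd := by
    by_cases hE' : E'.1.1 = ∅
    · have hle : E' ≤ E := VisscherFace.le_iff.2 (by simp [hE', E'.2.1 hE'])
      rw [visscherDim_eq_neg_one_iff.2 hE'] at hd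
      simp [visscherSign_of_eq_empty hE' (by omega : visscherDim E = 0), hle]
    · have hE' := Finset.nonempty_iff_ne_empty.2 hE'
      refine ⟨fun h => by_contra fun hle => h (visscherSign_of_not_le hE' hle), fun hle => ?_⟩
      obtain ⟨c, hc, h⟩ := VisscherFace.exists_support_eq_erase hE' hle hd
      rw [visscherSign_of_support_eq_erase hE' hc h]
      exact pow_ne_zero _ (by decide)
  vertex E E₀ hE h₀ := visscherSign_of_eq_empty (visscherDim_eq_neg_one_iff.1 h₀) hE
  cancel E E' E'' G hne hE' hE'' hG hle' hle'' hG' hG'' := by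
    by_cases hGe : G.1.1 = ∅
    · have hGd := visscherDim_eq_neg_one_iff.2 hGe
      obtain ⟨v, w, -, -, -, -, -, huniq, hsum⟩ :=
        VisscherFace.exists_endpoints (E := E) (by omega)
      rw [visscherSign_of_eq_empty hGe (by omega : visscherDim E' = 0),
        visscherSign_of_eq_empty hGe (by omega : visscherDim E'' = 0), mul_one, mul_one]
      rcases huniq E' (by omega) hle' with rfl | rfl <;>
        rcases huniq E'' (by omega) hle'' with rfl | rfl
      · exact absurd rfl hne
      · exact hsum
      · rw [add_comm, hsum]
      · exact absurd rfl hne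
    · have hGn := Finset.nonempty_iff_ne_empty.2 hGe
      have hn' := hGn.mono hG'.1
      have hn'' := hGn.mono hG''.1
      obtain ⟨c, hc, h1⟩ := VisscherFace.exists_support_eq_erase hn' hle' hE'
      obtain ⟨c', hc', h2⟩ := VisscherFace.exists_support_eq_erase hn'' hle'' hE''
      have hcc : c ≠ c' := by
        rintro rfl
        exact hne (VisscherFace.support_injective (h1.trans h2.symm))
      obtain ⟨e, he, h3⟩ := VisscherFace.exists_support_eq_erase hGn hG' (by omega)
      obtain ⟨e', he', h4⟩ := VisscherFace.exists_support_eq_erase hGn hG'' (by omega)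
      have hsub' := VisscherFace.le_iff_support.1 hG'
      have hsub'' := VisscherFace.le_iff_support.1 hG''
      obtain rfl : e = c' := by
        by_contra h
        have : c' ∈ G.support := by
          rw [h3, h1]; simp [Ne.symm h, hcc.symm, hc']
        have := hsub'' this
        rw [h2] at this
        simp at this
      obtain rfl : e' = c := by
        by_contra h
        have : c ∈ G.support := by
          rw [h4, h2]; simp [Ne.symm h, hcc, hc]
        have := hsub' this
        rw [h1] at this
        simp at this
      rw [visscherSign_of_support_eq_erase hn' hc h1, visscherSign_of_support_eq_erase hn'' hc' h2,
        visscherSign_of_support_eq_erase hGn he h3, visscherSign_of_support_eq_erase hGn he' h4,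
        h1, h2]
      exact neg_one_pow_erase_add_neg_one_pow_erase toLex.injective hc hc' hcc

/-- The diamond property: between a face and a face of codimension two there are exactly two
faces. -/
theorem VisscherFace.exists_diamond {E G : VisscherFace m n} (hle : G ≤ E)
    (hd : visscherDim G = visscherDim E - 2) :
    ∃ E₁ E₂ : VisscherFace m n, E₁ ≠ E₂ ∧
      (visscherDim E₁ = visscherDim E - 1 ∧ E₁ ≤ E ∧ G ≤ E₁) ∧
      (visscherDim E₂ = visscherDim E - 1 ∧ E₂ ≤ E ∧ G ≤ E₂) ∧
      ∀ E', visscherDim E' = visscherDim E - 1 → E' ≤ E → G ≤ E' → E' = E₁ ∨ E' = E₂ := by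
  by_cases hGe : G.1.1 = ∅
  · have hGd := visscherDim_eq_neg_one_iff.2 hGe
    have hGle (F : VisscherFace m n) : G ≤ F := le_iff.2 (by simp [hGe, G.2.1 hGe])
    obtain ⟨v, w, hne, hv, hw, hvE, hwE, huniq, -⟩ := exists_endpoints (E := E) (by omega)
    exact ⟨v, w, hne, ⟨by omega, hvE, hGle v⟩, ⟨by omega, hwE, hGle w⟩,
      fun E' h1 h2 _ => huniq E' (by omega) h2⟩
  · have hGn := Finset.nonempty_iff_ne_empty.2 hGe
    have hEn := hGn.mono hle.1
    have hsub := le_iff_support.1 hle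
    have hcard : (E.support \ G.support).card = 2 := by
      rw [visscherDim_eq_card_support hGn, visscherDim_eq_card_support hEn] at hd
      rw [Finset.card_sdiff_of_subset hsub]
      omega
    obtain ⟨c, c', hcc, hS⟩ := Finset.card_eq_two.1 hcard
    have hmem (x) : x ∈ E.support ∧ x ∉ G.support ↔ x = c ∨ x = c' := by
      rw [← Finset.mem_sdiff, hS]; simp
    have hc := (hmem c).2 (Or.inl rfl)
    have hc' := (hmem c').2 (Or.inr rfl)
    have key (c) (hc : c ∈ E.support ∧ c ∉ G.support) : ∃ E' : VisscherFace m n,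
        E'.support = E.support.erase c ∧
          (visscherDim E' = visscherDim E - 1 ∧ E' ≤ E ∧ G ≤ E') := by
      have hGs : G.support ⊆ E.support.erase c := fun x hx =>
        Finset.mem_erase.2 ⟨fun h => hc.2 (h ▸ hx), hsub hx⟩
      obtain ⟨E', hE'n, hE'⟩ := exists_support_eq hGn hGs
      refine ⟨E', hE', ?_, le_iff_support.2 (hE' ▸ Finset.erase_subset _ _),
        le_iff_support.2 (hE' ▸ hGs)⟩
      rw [visscherDim_eq_card_support hE'n, visscherDim_eq_card_support hEn, hE']
      have := Finset.card_erase_add_one hc.1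
      omega
    obtain ⟨E₁, h1, h1'⟩ := key c hc
    obtain ⟨E₂, h2, h2'⟩ := key c' hc'
    refine ⟨E₁, E₂, ?_, h1', h2', fun E' hd' hE' hG' => ?_⟩
    · rintro rfl
      exact Finset.notMem_erase c' _ (h2 ▸ h1 ▸ Finset.mem_erase.2 ⟨hcc.symm, hc'.1⟩)
    · obtain ⟨e, he, h3⟩ := exists_support_eq_erase (hGn.mono hG'.1) hE' hd'
      have heG : e ∉ G.support := fun h =>
        Finset.notMem_erase e _ (h3 ▸ le_iff_support.1 hG' h)
      rcases (hmem e).1 ⟨he, heG⟩ with rfl | rfl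
      · exact Or.inl (support_injective (h3.trans h1.symm))
      · exact Or.inr (support_injective (h3.trans h2.symm))

end VisscherSigns

/-! ### Strands of a labelled cellular complex -/

section CellularStrands

variable {ι : Type*} {k : Type*} [Field k] {dim : ι → ℤ}

theorem cellularAugmentation_single {S : Type*} [CommRing S] (I : Ideal S)
    (E : {E : ι // dim E = ((0 : ℕ) : ℤ) - 1}) (p : S) :
    cellularAugmentation dim I (Finsupp.single E p) = Ideal.Quotient.mk I p := by
  rw [cellularAugmentation, Finsupp.linearCombination_single, Algebra.smul_def, mul_one]
  rfl

theorem surjective_cellularAugmentation {S : Type*} [CommRing S] (hempty : ∃ E, dim E = -1)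
    (I : Ideal S) : Function.Surjective (cellularAugmentation dim I) := by
  obtain ⟨E₀, hE₀⟩ := hempty
  intro q
  obtain ⟨p, rfl⟩ := Ideal.Quotient.mk_surjective q
  exact ⟨Finsupp.single ⟨E₀, by simpa using hE₀⟩ p, cellularAugmentation_single I _ p⟩

variable [Fintype ι] {ε : ι → ι → ℤ}

variable (k dim ε) in
/-- The cellular boundary map over the field `k` on chains of mixed dimension, a chain being the
function that gives the coefficient of each cell. -/
def cellBoundary : (ι → k) →ₗ[k] (ι → k) where
  toFun g E' := ∑ E, if dim E' = dim E - 1 then (ε E E' : k) * g E else 0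
  map_add' g h := by
    ext E'
    simp only [Pi.add_apply, ← Finset.sum_add_distrib]
    refine Finset.sum_congr rfl fun E _ => ?_
    split_ifs <;> ring
  map_smul' c g := by
    ext E'
    simp only [Pi.smul_apply, smul_eq_mul, RingHom.id_apply, Finset.mul_sum]
    refine Finset.sum_congr rfl fun E _ => ?_
    split_ifs <;> ring

theorem cellBoundary_apply (g : ι → k) (E' : ι) :
    cellBoundary k dim ε g E' = ∑ E, if dim E' = dim E - 1 then (ε E E' : k) * g E else 0 := rfl

variable [PartialOrder ι] {σ : Type*} {f : {v : ι // dim v = 0} → (σ →₀ ℕ)}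

theorem cellLabel_le_iff {E : ι} {u : σ →₀ ℕ} :
    cellLabel dim f E ≤ u ↔ ∀ v : {v : ι // dim v = 0}, (v : ι) ≤ E → f v ≤ u := by
  simp [cellLabel]

theorem cellLabel_mono {E E' : ι} (h : E' ≤ E) : cellLabel dim f E' ≤ cellLabel dim f E :=
  cellLabel_le_iff.2 fun v hv => cellLabel_le_iff.1 le_rfl v (hv.trans h)

theorem cellularDifferential_apply (d : ℕ) (z : CellularModule (MvPolynomial σ k) dim (d + 1))
    (E' : {E' : ι // dim E' = (d : ℤ) - 1}) :
    cellularDifferential k dim ε f d z E' =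
      ∑ E, z E * MvPolynomial.monomial
        (cellLabel dim f (E : ι) - cellLabel dim f (E' : ι)) ((ε E E' : ℤ) : k) := by
  classical
  rw [cellularDifferential, Finsupp.linearCombination_apply, Finsupp.sum_fintype _ _ (by simp),
    Finsupp.finsetSum_apply]
  refine Finset.sum_congr rfl fun E _ => ?_
  rw [Finsupp.smul_apply, Finsupp.finsetSum_apply, smul_eq_mul]
  congr 1
  rw [Finset.sum_eq_single E']
  · simp
  · exact fun E'' _ h => Finsupp.single_eq_of_ne h.symm
  · simp

open Classical in
variable (k dim f) in
/-- The strand in multidegree `u`: the chain over `k` of the coefficients of the monomial `x ^ u`,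
where the basis element `E` is given the multidegree of its label. -/
noncomputable def cellularStrand (u : σ →₀ ℕ) (d : ℕ) :
    CellularModule (MvPolynomial σ k) dim d →+ (ι → k) where
  toFun z E := if h : dim E = (d : ℤ) - 1 ∧ cellLabel dim f E ≤ u then
    MvPolynomial.coeff (u - cellLabel dim f E) (z ⟨E, h.1⟩) else 0
  map_zero' := by
    ext E
    simp
  map_add' z z' := by
    ext E
    by_cases h : dim E = (d : ℤ) - 1 ∧ cellLabel dim f E ≤ u
    · simp [h]
    · simp [h]

theorem cellularStrand_of_mem {u : σ →₀ ℕ} {d : ℕ} (z : CellularModule (MvPolynomial σ k) dim d)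
    (E : {E : ι // dim E = (d : ℤ) - 1}) (h : cellLabel dim f (E : ι) ≤ u) :
    cellularStrand k dim f u d z E = MvPolynomial.coeff (u - cellLabel dim f (E : ι)) (z E) :=
  dif_pos ⟨E.2, h⟩

theorem cellularStrand_of_notMem {u : σ →₀ ℕ} {d : ℕ}
    (z : CellularModule (MvPolynomial σ k) dim d) {E : ι}
    (h : ¬ (dim E = (d : ℤ) - 1 ∧ cellLabel dim f E ≤ u)) :
    cellularStrand k dim f u d z E = 0 :=
  dif_neg h

/-- An element is determined by its strands. -/
theorem eq_of_cellularStrand_eq {d : ℕ} {z z' : CellularModule (MvPolynomial σ k) dim d}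
    (h : ∀ u, cellularStrand k dim f u d z = cellularStrand k dim f u d z') : z = z' := by
  ext E v
  have h1 := congrFun (h (v + cellLabel dim f (E : ι))) E
  rwa [cellularStrand_of_mem _ _ le_add_self, cellularStrand_of_mem _ _ le_add_self,
    add_tsub_cancel_right] at h1

theorem exists_finset_cellularStrand_eq_zero (d : ℕ)
    (z : CellularModule (MvPolynomial σ k) dim d) :
    ∃ T : Finset (σ →₀ ℕ), ∀ u ∉ T, cellularStrand k dim f u d z = 0 := by
  classical
  refine ⟨Finset.univ.biUnion fun E => (z E).support.image (· + cellLabel dim f (E : ι)),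
    fun u hu => funext fun E => ?_⟩
  by_cases h : dim E = (d : ℤ) - 1 ∧ cellLabel dim f E ≤ u
  · rw [cellularStrand_of_mem z ⟨E, h.1⟩ h.2, Pi.zero_apply]
    by_contra hne
    refine hu (Finset.mem_biUnion.2 ⟨⟨E, h.1⟩, Finset.mem_univ _, Finset.mem_image.2
      ⟨_, MvPolynomial.mem_support_iff.2 hne, tsub_add_cancel_of_le h.2⟩⟩)
  · rw [cellularStrand_of_notMem z h, Pi.zero_apply]

/-- Taking strands commutes with the differentials. -/
theorem cellularStrand_differential
    (hε : ∀ E E', dim E' = dim E - 1 → ε E E' ≠ 0 → E' ≤ E) (u : σ →₀ ℕ) (d : ℕ)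
    (z : CellularModule (MvPolynomial σ k) dim (d + 1)) :
    cellularStrand k dim f u d (cellularDifferential k dim ε f d z) =
      cellBoundary k dim ε (cellularStrand k dim f u (d + 1) z) := by
  classical
  ext E'
  rw [cellBoundary_apply]
  by_cases h : dim E' = (d : ℤ) - 1 ∧ cellLabel dim f E' ≤ u
  · rw [cellularStrand_of_mem _ ⟨E', h.1⟩ h.2, cellularDifferential_apply, MvPolynomial.coeff_sum]
    refine Finset.sum_bij_ne_zero (fun E _ _ => (E : ι)) (fun _ _ _ => Finset.mem_univ _)
      (fun _ _ _ _ _ _ h => Subtype.ext h) (fun E _ hE => ?_) (fun E _ hE => ?_)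
    · split_ifs at hE with hd
      · have hdE : dim E = ((d + 1 : ℕ) : ℤ) - 1 := by push_cast; linarith [h.1]
        have hEε : ε E E' ≠ 0 := fun h0 => hE (by simp [h0])
        have hle := cellLabel_mono (f := f) (hε E E' hd hEε)
        refine ⟨⟨E, hdE⟩, Finset.mem_univ _, ?_, rfl⟩
        have hEu : cellLabel dim f E ≤ u := by
          by_contra hn
          exact hE (by rw [cellularStrand_of_notMem _ fun h => hn h.2, mul_zero])
        rw [cellularStrand_of_mem z ⟨E, hdE⟩ hEu] at hE
        rw [MvPolynomial.coeff_mul_monomial', if_pos (tsub_le_tsub_right hEu _),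
          tsub_tsub_tsub_cancel_right hle, mul_comm]
        exact hE
      · exact absurd rfl hE
    · have hd : dim E' = dim (E : ι) - 1 := by
        have := E.2
        push_cast at this
        linarith [h.1]
      have hEε : ε E E' ≠ 0 := fun h0 => hE (by simp [h0])
      have hle := cellLabel_mono (f := f) (hε E E' hd hEε)
      rw [if_pos hd]
      rw [MvPolynomial.coeff_mul_monomial'] at hE ⊢
      split_ifs at hE ⊢ with hsub
      · have hEu : cellLabel dim f (E : ι) ≤ u := (tsub_le_tsub_iff_right h.2).1 hsub
        rw [cellularStrand_of_mem z E hEu, tsub_tsub_tsub_cancel_right hle, mul_comm]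
      · exact absurd rfl hE
  · rw [cellularStrand_of_notMem _ h]
    refine (Finset.sum_eq_zero fun E _ => ?_).symm
    split_ifs with hd
    · by_cases hEε : ε E E' = 0
      · simp [hEε]
      · rw [cellularStrand_of_notMem, mul_zero]
        rintro ⟨h1, h2⟩
        refine h ⟨?_, (cellLabel_mono (hε E E' hd hEε)).trans h2⟩
        rw [hd, h1]
        push_cast
        ring
    · rfl

variable (k dim f) in
/-- The homogeneous element of multidegree `u` with strand `g`. -/
noncomputable def homogeneousLift (u : σ →₀ ℕ) (d : ℕ) (g : ι → k) :
    CellularModule (MvPolynomial σ k) dim d :=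
  ∑ E : {E : ι // dim E = (d : ℤ) - 1},
    Finsupp.single E (MvPolynomial.monomial (u - cellLabel dim f (E : ι)) (g E))

open Classical in
theorem cellularStrand_homogeneousLift {u : σ →₀ ℕ} {d : ℕ} {g : ι → k}
    (hg : ∀ E, g E ≠ 0 → dim E = (d : ℤ) - 1 ∧ cellLabel dim f E ≤ u) (u' : σ →₀ ℕ) :
    cellularStrand k dim f u' d (homogeneousLift k dim f u d g) = if u = u' then g else 0 := by
  ext E
  by_cases h : dim E = (d : ℤ) - 1 ∧ cellLabel dim f E ≤ u'
  · rw [cellularStrand_of_mem _ ⟨E, h.1⟩ h.2, homogeneousLift, Finsupp.finsetSum_apply,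
      Finset.sum_eq_single (⟨E, h.1⟩ : {E : ι // dim E = (d : ℤ) - 1})
        (fun E'' _ h => Finsupp.single_eq_of_ne h.symm) (by simp), Finsupp.single_eq_same,
      MvPolynomial.coeff_monomial]
    by_cases hgE : g E = 0
    · simp [hgE, ite_apply]
    · have := tsub_left_inj (hg E hgE).2 h.2
      simp only [this]
      split_ifs <;> rfl
  · rw [cellularStrand_of_notMem _ h]
    split_ifs with hu
    · by_contra hne
      exact h (hu ▸ hg E (Ne.symm hne))
    · rfl

/-- If the subcomplexes of the cells with label dividing a given monomial are acyclic over `k` in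
nonnegative dimensions, then the labelled cellular complex is exact in positive degrees. -/
theorem cellularDifferential_exact
    (hε : ∀ E E', dim E' = dim E - 1 → ε E E' ≠ 0 → E' ≤ E)
    (hsq : ∀ g, cellBoundary k dim ε (cellBoundary k dim ε g) = 0)
    (hac : ∀ (u : σ →₀ ℕ) (d : ℕ) (g : ι → k),
      (∀ E, g E ≠ 0 → dim E = d ∧ cellLabel dim f E ≤ u) → cellBoundary k dim ε g = 0 →
      ∃ w : ι → k, (∀ E, w E ≠ 0 → cellLabel dim f E ≤ u) ∧ cellBoundary k dim ε w = g) (i : ℕ) :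
    Function.Exact (cellularDifferential k dim ε f (i + 1)) (cellularDifferential k dim ε f i) := by
  classical
  intro z
  constructor
  · intro hz
    have hsupp (u) (E) (hE : cellularStrand k dim f u (i + 1) z E ≠ 0) :
        dim E = (i : ℤ) ∧ cellLabel dim f E ≤ u := by
      by_contra hn
      refine hE (cellularStrand_of_notMem z fun h => hn ⟨?_, h.2⟩)
      rw [h.1]; push_cast; ring
    have hcyc (u) : cellBoundary k dim ε (cellularStrand k dim f u (i + 1) z) = 0 := by
      rw [← cellularStrand_differential hε, hz, map_zero]
    choose w hw hwb using fun u => hac u i _ (hsupp u) (hcyc u)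
    -- Only the part of `w u` in dimension `i + 1` contributes to a boundary in dimension `i`.
    let w' : (σ →₀ ℕ) → ι → k := fun u E => if dim E = i + 1 then w u E else 0
    have hw' (u) (E) (hE : w' u E ≠ 0) :
        dim E = ((i + 1 + 1 : ℕ) : ℤ) - 1 ∧ cellLabel dim f E ≤ u := by
      simp only [w'] at hE
      split_ifs at hE with hd
      · exact ⟨by rw [hd]; push_cast; ring, hw u E hE⟩
      · exact absurd rfl hE
    have hwb' (u) : cellBoundary k dim ε (w' u) = cellularStrand k dim f u (i + 1) z := by
      ext E'
      by_cases hd : dim E' = i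
      · rw [← hwb u, cellBoundary_apply, cellBoundary_apply]
        refine Finset.sum_congr rfl fun E _ => ?_
        split_ifs with h
        · simp only [w']
          rw [if_pos (by omega)]
        · rfl
      · rw [not_not.1 (mt (hsupp u E') fun h => hd h.1), cellBoundary_apply]
        refine Finset.sum_eq_zero fun E _ => ?_
        split_ifs with h
        · simp only [w']
          rw [if_neg (by omega), mul_zero]
        · rfl
    obtain ⟨T, hT⟩ := exists_finset_cellularStrand_eq_zero (f := f) (i + 1) z
    refine ⟨∑ u ∈ T, homogeneousLift k dim f u (i + 1 + 1) (w' u),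
      eq_of_cellularStrand_eq (f := f) fun u => ?_⟩
    rw [cellularStrand_differential hε, map_sum,
      Finset.sum_congr rfl fun u' _ => cellularStrand_homogeneousLift (hw' u') u,
      Finset.sum_ite_eq']
    split_ifs with hu
    · exact hwb' u
    · rw [map_zero, hT u hu]
  · rintro ⟨y, rfl⟩
    refine eq_of_cellularStrand_eq (f := f) fun u => ?_
    rw [cellularStrand_differential hε, cellularStrand_differential hε, hsq, map_zero]

theorem cellBoundary_cellBoundary (hinc : IsIncidenceFunction dim ε)
    (hdiamond : ∀ E G, G ≤ E → dim G = dim E - 2 → ∃ E₁ E₂, E₁ ≠ E₂ ∧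
      (dim E₁ = dim E - 1 ∧ E₁ ≤ E ∧ G ≤ E₁) ∧ (dim E₂ = dim E - 1 ∧ E₂ ≤ E ∧ G ≤ E₂) ∧
      ∀ E', dim E' = dim E - 1 → E' ≤ E → G ≤ E' → E' = E₁ ∨ E' = E₂) (g : ι → k) :
    cellBoundary k dim ε (cellBoundary k dim ε g) = 0 := by
  classical
  have key (E G : ι) : ∑ E', (if dim G = dim E' - 1 ∧ dim E' = dim E - 1 then
      ε E E' * ε E' G else 0) = 0 := by
    have hle (E') (h : (if dim G = dim E' - 1 ∧ dim E' = dim E - 1 then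
        ε E E' * ε E' G else 0) ≠ 0) :
        dim G = dim E' - 1 ∧ dim E' = dim E - 1 ∧ E' ≤ E ∧ G ≤ E' := by
      split_ifs at h with hd
      · exact ⟨hd.1, hd.2, (hinc.ne_zero_iff _ _ hd.2).1 (left_ne_zero_of_mul h),
          (hinc.ne_zero_iff _ _ hd.1).1 (right_ne_zero_of_mul h)⟩
      · exact absurd rfl h
    by_cases hGE : G ≤ E ∧ dim G = dim E - 2
    · obtain ⟨E₁, E₂, hne, h1, h2, huniq⟩ := hdiamond E G hGE.1 hGE.2
      rw [← Finset.sum_subset (Finset.subset_univ {E₁, E₂}), Finset.sum_pair hne,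
        if_pos ⟨by omega, h1.1⟩, if_pos ⟨by omega, h2.1⟩]
      · exact hinc.cancel E E₁ E₂ G hne h1.1 h2.1 hGE.2 h1.2.1 h2.2.1 h1.2.2 h2.2.2
      · intro E' _ hE'
        by_contra h
        obtain ⟨-, h3, h4, h5⟩ := hle E' h
        exact hE' (by simpa using huniq E' h3 h4 h5)
    · refine Finset.sum_eq_zero fun E' _ => by_contra fun h => hGE ?_
      obtain ⟨h3, h4, h5, h6⟩ := hle E' h
      exact ⟨h6.trans h5, by omega⟩
  ext G
  have h1 : cellBoundary k dim ε (cellBoundary k dim ε g) G = ∑ E, ((∑ E',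
      (if dim G = dim E' - 1 ∧ dim E' = dim E - 1 then ε E E' * ε E' G else 0 : ℤ) : ℤ) : k) *
        g E := by
    simp only [cellBoundary_apply]
    simp only [Int.cast_sum, Finset.sum_mul]
    rw [Finset.sum_comm]
    refine Finset.sum_congr rfl fun E' _ => ?_
    by_cases h : dim G = dim E' - 1
    · simp only [h, true_and, if_true, Finset.mul_sum]
      refine Finset.sum_congr rfl fun E _ => ?_
      split_ifs <;> push_cast <;> ring
    · simp [h]
  rw [h1]
  simp [key]

theorem cellLabel_of_dim_eq_zero (hdim : ∀ E E' : ι, E' < E → dim E' < dim E)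
    (v : {v : ι // dim v = 0}) : cellLabel dim f (v : ι) = f v := by
  refine le_antisymm (cellLabel_le_iff.2 fun w hw => ?_) (cellLabel_le_iff.1 le_rfl v le_rfl)
  rcases hw.eq_or_lt with h | h
  · rw [Subtype.ext h]
  · have := hdim _ _ h
    rw [v.2, w.2] at this
    exact absurd this (lt_irrefl _)

theorem cellLabel_of_dim_neg (hdim : ∀ E E' : ι, E' < E → dim E' < dim E) {E : ι}
    (hE : dim E < 0) : cellLabel dim f E = 0 := by
  refine le_antisymm (cellLabel_le_iff.2 fun v hv => ?_) zero_le
  rcases hv.eq_or_lt with h | h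
  · rw [← h, v.2] at hE
    exact absurd hE (lt_irrefl _)
  · have := hdim _ _ h
    rw [v.2] at this
    exact absurd this hE.not_gt

/-- The labelled cellular complex resolves the quotient by the ideal of the vertex labels, as far
as degree `0` is concerned. -/
theorem cellularDifferential_exact_augmentation (hinc : IsIncidenceFunction dim ε)
    (hdim : ∀ E E' : ι, E' < E → dim E' < dim E) (hempty : ∃! E, dim E = -1)
    {I : Ideal (MvPolynomial σ k)}
    (hI : I = Ideal.span (Set.range fun v => MvPolynomial.monomial (f v) (1 : k))) :
    Function.Exact (cellularDifferential k dim ε f 0) (cellularAugmentation dim I) := by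
  classical
  obtain ⟨E₀, hE₀, huniq⟩ := hempty
  let e : {E : ι // dim E = ((0 : ℕ) : ℤ) - 1} := ⟨E₀, by simpa using hE₀⟩
  have he (E) : E = e := Subtype.ext (huniq E (by simpa using E.2))
  have hz (z : CellularModule (MvPolynomial σ k) dim 0) : z = Finsupp.single e (z e) := by
    ext1 E
    rw [he E, Finsupp.single_eq_same]
  have hv (E : {E : ι // dim E = ((0 + 1 : ℕ) : ℤ) - 1}) : dim (E : ι) = 0 := by
    simpa using E.2
  have hd (E : {E : ι // dim E = ((0 + 1 : ℕ) : ℤ) - 1}) :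
      cellularDifferential k dim ε f 0 (Finsupp.single E 1) =
        Finsupp.single e (MvPolynomial.monomial (f ⟨E, hv E⟩) 1) := by
    rw [hz (cellularDifferential k dim ε f 0 (Finsupp.single E 1)), cellularDifferential_apply,
      Finset.sum_eq_single E, Finsupp.single_eq_same, one_mul,
      cellLabel_of_dim_eq_zero hdim ⟨E, hv E⟩, cellLabel_of_dim_neg hdim (E := (e : ι)),
      hinc.vertex _ _ (hv E) hE₀, tsub_zero, Int.cast_one]
    · change dim E₀ < 0
      omega
    · intro E' _ hne
      rw [Finsupp.single_eq_of_ne hne, zero_mul]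
    · simp
  intro z
  constructor
  · intro h
    rw [hz z, cellularAugmentation_single, Ideal.Quotient.eq_zero_iff_mem, hI] at h
    have hle : Ideal.span (Set.range fun v => MvPolynomial.monomial (f v) (1 : k)) ≤
        (LinearMap.range (cellularDifferential k dim ε f 0)).comap (Finsupp.lsingle e) := by
      refine Ideal.span_le.2 ?_
      rintro _ ⟨v, rfl⟩
      exact ⟨Finsupp.single ⟨v, by simpa using v.2⟩ 1, hd _⟩
    rw [hz z]
    exact hle h
  · rintro ⟨y, rfl⟩
    have hcomp : (cellularAugmentation dim I) ∘ₗ (cellularDifferential k dim ε f 0) = 0 := by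
      refine Finsupp.lhom_ext' fun E => LinearMap.ext_ring ?_
      rw [LinearMap.comp_apply, LinearMap.comp_apply, Finsupp.lsingle_apply, hd,
        cellularAugmentation_single, LinearMap.comp_apply, LinearMap.zero_apply,
        Ideal.Quotient.eq_zero_iff_mem, hI]
      exact Ideal.subset_span ⟨_, rfl⟩
    exact LinearMap.congr_fun hcomp y

/-- The complex is minimal when the labels of each cell and of its facets are distinct. -/
theorem range_cellularDifferential_le
    (hε : ∀ E E', dim E' = dim E - 1 → ε E E' ≠ 0 → E' ≤ E)
    (hlabel : ∀ E E', dim E' = dim E - 1 → E' ≤ E → cellLabel dim f E ≠ cellLabel dim f E')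
    (d : ℕ) : LinearMap.range (cellularDifferential k dim ε f d) ≤
      MvPolynomial.idealOfVars σ k •
        (⊤ : Submodule (MvPolynomial σ k) (CellularModule (MvPolynomial σ k) dim d)) := by
  classical
  rw [cellularDifferential, Finsupp.range_linearCombination, Submodule.span_le]
  rintro _ ⟨E, rfl⟩
  refine Submodule.sum_mem _ fun E' _ => ?_
  have hd : dim (E' : ι) = dim (E : ι) - 1 := by
    have := E.2
    push_cast at this
    rw [E'.2, this]
    ring
  by_cases h0 : ε E E' = 0
  · simp [h0]
  · rw [← mul_one (MvPolynomial.monomial _ _), ← smul_eq_mul, ← Finsupp.smul_single]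
    refine Submodule.smul_mem_smul ?_ Submodule.mem_top
    have hle := hε _ _ hd h0
    have hne : cellLabel dim f (E : ι) - cellLabel dim f (E' : ι) ≠ 0 := fun h =>
      hlabel _ _ hd hle (le_antisymm (tsub_eq_zero_iff_le.1 h) (cellLabel_mono hle))
    rw [← pow_one (MvPolynomial.idealOfVars σ k), MvPolynomial.mem_pow_idealOfVars_iff']
    intro x hx
    rw [MvPolynomial.coeff_monomial, if_neg]
    rintro rfl
    rw [Nat.lt_one_iff, Finsupp.degree_eq_zero_iff] at hx
    exact hne hx

end CellularStrands

/-! ### Acyclicity by matchings -/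

section Matchings

variable {ι : Type*} {k : Type*} [Field k] {dim : ι → ℤ} [Fintype ι] {ε : ι → ι → ℤ}

theorem eq_zero_of_cellBoundary_eq_zero [PartialOrder ι] (hinc : IsIncidenceFunction dim ε)
    {g : ι → k} {E L : ι} (hd : dim L = dim E - 1) (hle : L ≤ E)
    (huniq : ∀ F, g F ≠ 0 → dim L = dim F - 1 → L ≤ F → F = E)
    (h : cellBoundary k dim ε g L = 0) : g E = 0 := by
  rw [cellBoundary_apply, Finset.sum_eq_single E _ (by simp), if_pos hd] at h
  · have hε : (ε E L : k) ≠ 0 := by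
      have h0 := (hinc.ne_zero_iff E L hd).2 hle
      rcases hinc.values E L hd with h1 | h1 | h1
      · exact absurd h1 h0
      · simp [h1]
      · simp [h1]
    exact (mul_eq_zero.1 h).resolve_left hε
  · intro F _ hF
    split_ifs with hdF
    · by_contra hne
      exact hF (huniq F (right_ne_zero_of_mul hne) hdF ((hinc.ne_zero_iff F L hdF).1 fun h0 =>
        left_ne_zero_of_mul hne (by rw [h0, Int.cast_zero])))
    · rfl

/-- Let the cells of a subcomplex `Δ` be matched by a map `down` from a set `U` of cells onto the
remaining ones. If a chain on `U` whose boundary vanishes on all of `down U` is zero, then `Δ` is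
acyclic: by finite dimensionality every chain can be changed by a boundary into a chain on `U`. -/
theorem exists_cellBoundary_eq_of_matching {Δ U : Set ι} {down : ι → ι} (hU : U ⊆ Δ)
    (hdown : ∀ L ∈ Δ, L ∉ U → ∃ E ∈ U, down E = L)
    (hinj : ∀ g : ι → k, (∀ E, g E ≠ 0 → E ∈ U) →
      (∀ E ∈ U, cellBoundary k dim ε g (down E) = 0) → g = 0)
    (hΔ : ∀ g : ι → k, (∀ E, g E ≠ 0 → E ∈ Δ) → ∀ E, cellBoundary k dim ε g E ≠ 0 → E ∈ Δ)
    (hsq : ∀ g, cellBoundary k dim ε (cellBoundary k dim ε g) = 0)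
    {z : ι → k} (hz : ∀ E, z E ≠ 0 → E ∈ Δ) (hz0 : cellBoundary k dim ε z = 0) :
    ∃ w : ι → k, (∀ E, w E ≠ 0 → E ∈ Δ) ∧ cellBoundary k dim ε w = z := by
  classical
  let ext : (U → k) →ₗ[k] (ι → k) := Function.ExtendByZero.linearMap k (Subtype.val : U → ι)
  have ext_mem (w : U → k) (E : U) : ext w E = w E :=
    Subtype.val_injective.extend_apply w (0 : ι → k) E
  have ext_notMem (w : U → k) (E : ι) (h : E ∉ U) : ext w E = 0 :=
    Function.extend_apply' w (0 : ι → k) E fun ⟨E', hE'⟩ => h (hE' ▸ E'.2)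
  have ext_supp (w : U → k) (E : ι) (h : ext w E ≠ 0) : E ∈ U :=
    by_contra fun hE => h (ext_notMem w E hE)
  let T : (U → k) →ₗ[k] (U → k) :=
    LinearMap.funLeft k k (fun E : U => down E) ∘ₗ cellBoundary k dim ε ∘ₗ ext
  have hT (w : U → k) (E : U) : T w E = cellBoundary k dim ε (ext w) (down E) := rfl
  have hTinj : Function.Injective T := by
    rw [injective_iff_map_eq_zero]
    intro w hw
    have h := hinj (ext w) (ext_supp w) fun E hE => by rw [← hT w ⟨E, hE⟩, hw, Pi.zero_apply]
    ext E
    rw [← ext_mem w E, h, Pi.zero_apply, Pi.zero_apply]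
  obtain ⟨w, hw⟩ := LinearMap.injective_iff_surjective.1 hTinj fun E => z (down E)
  have hwΔ (E) (hE : ext w E ≠ 0) : E ∈ Δ := hU (ext_supp w E hE)
  refine ⟨ext w, hwΔ, (sub_eq_zero.1 (hinj (z - cellBoundary k dim ε (ext w)) (fun E hE => ?_)
    fun E _ => ?_)).symm⟩
  · by_contra hEU
    by_cases hEΔ : E ∈ Δ
    · obtain ⟨F, hF, rfl⟩ := hdown E hEΔ hEU
      rw [Pi.sub_apply, ← hT w ⟨F, hF⟩, hw, sub_self] at hE
      exact hE rfl
    · rw [Pi.sub_apply, not_not.1 (mt (hz E) hEΔ), not_not.1 (mt (hΔ _ hwΔ E) hEΔ),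
        sub_zero] at hE
      exact hE rfl
  · rw [map_sub, hz0, hsq, sub_zero, Pi.zero_apply]

end Matchings

/-! ### Acyclicity of products of simplices -/

section VisscherAcyclic

variable {m n : ℕ} {k : Type*} [Field k]

/-- The matching on the faces of the complex given by the vertices `X_a` and `Y_b`: remove `X_a`
if this leaves other vertices `X_i`, otherwise remove `Y_b` if this leaves other vertices `Y_j`,
and match the vertex `(a, b)` with the empty face. -/
def visscherDown (a : Fin m) (b : Fin n) (E : VisscherFace m n) : VisscherFace m n :=
  if h : E.1.1 = {a} then
    if h' : E.1.2 = {b} then ⟨(∅, ∅), by simp⟩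
    else ⟨({a}, E.1.2.erase b), by
      have : E.1.2 ≠ ∅ := fun h2 => by simpa [h] using E.2.2 h2
      simp [Finset.erase_eq_empty_iff, this, h']⟩
  else ⟨(E.1.1.erase a, E.1.2), by
    simpa only [Finset.erase_eq_empty_iff, h, or_false] using E.2⟩

/-- The faces that `visscherDown` matches with a facet. -/
def visscherUpper (a : Fin m) (b : Fin n) : Set (VisscherFace m n) :=
  {E | a ∈ E.1.1 ∧ (E.1.1 = {a} → b ∈ E.1.2)}

theorem visscherDown_of_fst_ne {a : Fin m} {b : Fin n} {E : VisscherFace m n}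
    (h : E.1.1 ≠ {a}) : (visscherDown a b E).1 = (E.1.1.erase a, E.1.2) := by
  rw [visscherDown, dif_neg h]

theorem visscherDown_of_snd_ne {a : Fin m} {b : Fin n} {E : VisscherFace m n}
    (h : E.1.1 = {a}) (h' : E.1.2 ≠ {b}) : (visscherDown a b E).1 = ({a}, E.1.2.erase b) := by
  rw [visscherDown, dif_pos h, dif_neg h']

theorem visscherDown_of_eq {a : Fin m} {b : Fin n} {E : VisscherFace m n}
    (h : E.1.1 = {a}) (h' : E.1.2 = {b}) : (visscherDown a b E).1 = (∅, ∅) := by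
  rw [visscherDown, dif_pos h, dif_pos h']

theorem visscherDown_le {a : Fin m} {b : Fin n} {E : VisscherFace m n} :
    visscherDown a b E ≤ E := by
  rw [VisscherFace.le_iff]
  by_cases h : E.1.1 = {a}
  · by_cases h' : E.1.2 = {b}
    · simp [visscherDown_of_eq h h']
    · rw [visscherDown_of_snd_ne h h']
      exact ⟨h.ge, Finset.erase_subset _ _⟩
  · rw [visscherDown_of_fst_ne h]
    exact ⟨Finset.erase_subset _ _, le_rfl⟩

theorem visscherDim_visscherDown {a : Fin m} {b : Fin n} {E : VisscherFace m n}
    (hE : E ∈ visscherUpper a b) :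
    visscherDim (visscherDown a b E) = visscherDim E - 1 := by
  have hEn : E.1.1.Nonempty := ⟨a, hE.1⟩
  rw [visscherDim_of_nonempty hEn]
  by_cases h : E.1.1 = {a}
  · by_cases h' : E.1.2 = {b}
    · rw [visscherDim_eq_neg_one_iff.2 (by rw [visscherDown_of_eq h h']), h, h']
      simp
    · rw [visscherDim_of_nonempty (by simp [visscherDown_of_snd_ne h h']),
        visscherDown_of_snd_ne h h', h]
      have := Finset.card_erase_add_one (hE.2 h)
      simp only
      omega
  · have hne : (E.1.1.erase a).Nonempty := by
      rw [Finset.nonempty_iff_ne_empty, Ne, Finset.erase_eq_empty_iff]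
      simp [h, hEn.ne_empty]
    rw [visscherDim_of_nonempty (by rw [visscherDown_of_fst_ne h]; exact hne),
      visscherDown_of_fst_ne h]
    have := Finset.card_erase_add_one hE.1
    simp only
    omega

/-- A face with a given nonempty facet is determined by a vertex of the graph that the facet
lacks. -/
theorem VisscherFace.eq_of_common_facet {L E F : VisscherFace m n} (hL : L.1.1.Nonempty)
    (hE : L ≤ E) (hdE : visscherDim L = visscherDim E - 1) (hF : L ≤ F)
    (hdF : visscherDim L = visscherDim F - 1) {c : Fin m ⊕ Fin n} (hc : c ∉ L.support)
    (hcE : c ∈ E.support) (hcF : c ∈ F.support) : F = E := by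
  have key (E : VisscherFace m n) (hE : L ≤ E) (hdE : visscherDim L = visscherDim E - 1)
      (hcE : c ∈ E.support) : E.support = insert c L.support := by
    obtain ⟨e, he, h⟩ := exists_support_eq_erase hL hE hdE
    have : e = c := by
      by_contra hne
      exact hc (h ▸ Finset.mem_erase.2 ⟨Ne.symm hne, hcE⟩)
    rw [h, this, Finset.insert_erase hcE]
  exact support_injective ((key F hF hdF hcF).trans (key E hE hdE hcE).symm)

theorem eq_zero_of_forall_cellBoundary_visscherDown_eq_zero
    {ε : VisscherFace m n → VisscherFace m n → ℤ} (hinc : IsIncidenceFunction visscherDim ε)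
    {a : Fin m} {b : Fin n} {U : Set (VisscherFace m n)} (hU : U ⊆ visscherUpper a b)
    {g : VisscherFace m n → k} (hg : ∀ E, g E ≠ 0 → E ∈ U)
    (h : ∀ E ∈ U, cellBoundary k visscherDim ε g (visscherDown a b E) = 0) : g = 0 := by
  have step (E) (hE : E ∈ U)
      (huniq : ∀ F, g F ≠ 0 → visscherDim (visscherDown a b E) = visscherDim F - 1 →
        visscherDown a b E ≤ F → F = E) : g E = 0 :=
    eq_zero_of_cellBoundary_eq_zero hinc (visscherDim_visscherDown (hU hE)) visscherDown_le huniq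
      (h E hE)
  -- The three kinds of matched pairs are treated in this order, because the facet in a pair of
  -- one kind may lie in the larger face of a pair of an earlier kind.
  have h1 (E) (hE : E.1.1 ≠ {a}) : g E = 0 := by
    by_contra hgE
    have hEU := hg E hgE
    refine hgE (step E hEU fun F hF hd hle => ?_)
    have hL := visscherDown_of_fst_ne (b := b) hE
    have hLn : (visscherDown a b E).1.1.Nonempty := by
      rw [hL, Finset.nonempty_iff_ne_empty, Ne, Finset.erase_eq_empty_iff]
      simp [hE, Finset.ne_empty_of_mem (hU hEU).1]
    exact VisscherFace.eq_of_common_facet hLn visscherDown_le (visscherDim_visscherDown (hU hEU))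
      hle hd (c := Sum.inl a) (by simp [VisscherFace.inl_mem_support, hL])
      (VisscherFace.inl_mem_support.2 (hU hEU).1)
      (VisscherFace.inl_mem_support.2 (hU (hg F hF)).1)
  have h2 (E) (hE : E.1.2 ≠ {b}) : g E = 0 := by
    by_contra hgE
    have hEU := hg E hgE
    have hEa : E.1.1 = {a} := by_contra fun hne => hgE (h1 E hne)
    refine hgE (step E hEU fun F hF hd hle => ?_)
    have hFa : F.1.1 = {a} := by_contra fun hne => hF (h1 F hne)
    have hL := visscherDown_of_snd_ne hEa hE
    exact VisscherFace.eq_of_common_facet (by simp [hL]) visscherDown_le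
      (visscherDim_visscherDown (hU hEU)) hle hd (c := Sum.inr b)
      (by simp [VisscherFace.inr_mem_support, hL])
      (VisscherFace.inr_mem_support.2 ((hU hEU).2 hEa))
      (VisscherFace.inr_mem_support.2 ((hU (hg F hF)).2 hFa))
  have heq (E) (hE : g E ≠ 0) : E.1 = ({a}, {b}) :=
    Prod.ext (by_contra fun hne => hE (h1 E hne)) (by_contra fun hne => hE (h2 E hne))
  ext E
  by_contra hgE
  exact hgE (step E (hg E hgE) fun F hF _ _ => Subtype.ext ((heq F hF).trans (heq E hgE).symm))

theorem exists_visscherDown_eq {a : Fin m} {b : Fin n} {L : VisscherFace m n}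
    (hL : L ∉ visscherUpper a b) : ∃ E ∈ visscherUpper a b, visscherDown a b E = L ∧
      E.support ⊆ insert (Sum.inl a) (insert (Sum.inr b) L.support) := by
  by_cases ha : a ∈ L.1.1
  · obtain ⟨hLa, hb⟩ : L.1.1 = {a} ∧ b ∉ L.1.2 := by
      by_contra h
      exact hL ⟨ha, fun h1 => by_contra fun h2 => h ⟨h1, h2⟩⟩
    have hLn : L.1.2 ≠ ∅ := fun h => Finset.ne_empty_of_mem ha (L.2.2 h)
    refine ⟨⟨({a}, insert b L.1.2), by simp⟩, ⟨by simp, by simp⟩, Subtype.ext ?_, ?_⟩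
    · rw [visscherDown_of_snd_ne rfl]
      · exact Prod.ext hLa.symm (Finset.erase_insert hb)
      · intro h
        have h3 : (insert b L.1.2).erase b = ({b} : Finset (Fin n)).erase b := by rw [← h]
        rw [Finset.erase_insert hb, Finset.erase_singleton] at h3
        exact hLn h3
    · rintro (i | j) hx
      · have := VisscherFace.inl_mem_support.1 hx
        simp_all
      · have := VisscherFace.inr_mem_support.1 hx
        simpa [VisscherFace.inr_mem_support] using this
  · by_cases hLe : L.1.1 = ∅
    · refine ⟨⟨({a}, {b}), by simp⟩, ⟨by simp, by simp⟩, Subtype.ext ?_, ?_⟩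
      · rw [visscherDown_of_eq rfl rfl]
        exact Prod.ext hLe.symm (L.2.1 hLe).symm
      · rintro (i | j) hx
        · have := VisscherFace.inl_mem_support.1 hx
          simp_all
        · have := VisscherFace.inr_mem_support.1 hx
          simp_all
    · have hLn : L.1.2 ≠ ∅ := fun h => hLe (L.2.2 h)
      have hne : insert a L.1.1 ≠ {a} := by
        intro h
        have h3 : (insert a L.1.1).erase a = ({a} : Finset (Fin m)).erase a := by rw [← h]
        rw [Finset.erase_insert ha, Finset.erase_singleton] at h3
        exact hLe h3
      refine ⟨⟨(insert a L.1.1, L.1.2), by simp [hLn]⟩, ⟨by simp, fun h => absurd h hne⟩,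
        Subtype.ext ?_, ?_⟩
      · rw [visscherDown_of_fst_ne hne]
        exact Prod.ext (Finset.erase_insert ha) rfl
      · rintro (i | j) hx
        · have := VisscherFace.inl_mem_support.1 hx
          simpa [VisscherFace.inl_mem_support] using this
        · have := VisscherFace.inr_mem_support.1 hx
          simpa [VisscherFace.inr_mem_support] using Or.inr this

theorem cellBoundary_cellBoundary_visscher {ε : VisscherFace m n → VisscherFace m n → ℤ}
    (hinc : IsIncidenceFunction visscherDim ε) (g : VisscherFace m n → k) :
    cellBoundary k visscherDim ε (cellBoundary k visscherDim ε g) = 0 :=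
  cellBoundary_cellBoundary hinc (fun _ _ => VisscherFace.exists_diamond) g

/-- The subcomplex induced on a set `Z` of vertices of the graph, being empty or a product of two
simplices, is acyclic in nonnegative dimensions. -/
theorem exists_cellBoundary_eq_visscher {ε : VisscherFace m n → VisscherFace m n → ℤ}
    (hinc : IsIncidenceFunction visscherDim ε) (Z : Set (Fin m ⊕ Fin n)) {d : ℕ}
    {g : VisscherFace m n → k} (hg : ∀ E, g E ≠ 0 → visscherDim E = d ∧ ∀ c ∈ E.support, c ∈ Z)
    (hg0 : cellBoundary k visscherDim ε g = 0) :
    ∃ w : VisscherFace m n → k, (∀ E, w E ≠ 0 → ∀ c ∈ E.support, c ∈ Z) ∧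
      cellBoundary k visscherDim ε w = g := by
  by_cases h : g = 0
  · exact ⟨0, fun E hE => absurd rfl hE, by rw [h, map_zero]⟩
  obtain ⟨E, hE⟩ := Function.ne_iff.1 h
  obtain ⟨hEd, hEZ⟩ := hg E hE
  have hEn : E.1.1.Nonempty := by
    rw [Finset.nonempty_iff_ne_empty, Ne, ← visscherDim_eq_neg_one_iff, hEd]
    omega
  obtain ⟨a, ha⟩ := hEn
  obtain ⟨b, hb⟩ := VisscherFace.fst_nonempty_iff_snd.1 ⟨a, ha⟩
  have haZ : Sum.inl a ∈ Z := hEZ _ (VisscherFace.inl_mem_support.2 ha)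
  have hbZ : Sum.inr b ∈ Z := hEZ _ (VisscherFace.inr_mem_support.2 hb)
  refine exists_cellBoundary_eq_of_matching (Δ := {E : VisscherFace m n | ∀ c ∈ E.support, c ∈ Z})
    (U := {E | ∀ c ∈ E.support, c ∈ Z} ∩ visscherUpper a b) (down := visscherDown a b)
    Set.inter_subset_left ?_ (fun g => eq_zero_of_forall_cellBoundary_visscherDown_eq_zero hinc
      Set.inter_subset_right) ?_ (cellBoundary_cellBoundary_visscher hinc)
    (fun E hE => (hg E hE).2) hg0
  · intro L hLZ hL
    obtain ⟨F, hF, hFL, hFs⟩ := exists_visscherDown_eq (a := a) (b := b) (L := L)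
      fun h => hL ⟨hLZ, h⟩
    refine ⟨F, ⟨fun x hx => ?_, hF⟩, hFL⟩
    rcases Finset.mem_insert.1 (hFs hx) with rfl | hx
    · exact haZ
    · rcases Finset.mem_insert.1 hx with rfl | hx
      · exact hbZ
      · exact hLZ _ hx
  · intro g hg E hE
    rw [cellBoundary_apply] at hE
    obtain ⟨F, -, hF⟩ := Finset.exists_ne_zero_of_sum_ne_zero hE
    split_ifs at hF with hd
    · have hle : E ≤ F := (hinc.ne_zero_iff F E hd).1 fun h0 =>
        left_ne_zero_of_mul hF (by rw [h0, Int.cast_zero])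
      exact fun c hc => hg F (right_ne_zero_of_mul hF) c (VisscherFace.le_iff_support.1 hle hc)
    · exact absurd rfl hF

end VisscherAcyclic

/-! ### The labels -/

section VisscherLabels

variable {m n : ℕ} {lam : Fin m ⊕ Fin n → ℕ}

theorem visscherVertexLabel_visscherVertex (q : Fin m × Fin n) :
    visscherVertexLabel lam (visscherVertex q) =
      Finsupp.single (Sum.inl q.1) (lam (Sum.inl q.1)) +
        Finsupp.single (Sum.inr q.2) (lam (Sum.inr q.2)) := by
  have h : (visscherVertexEquiv m n).symm (visscherVertex q) = q :=
    (visscherVertexEquiv m n).symm_apply_apply q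
  rw [visscherVertexLabel, h]

theorem cellLabel_visscher_le_iff {E : VisscherFace m n} {u : (Fin m ⊕ Fin n) →₀ ℕ} :
    cellLabel visscherDim (visscherVertexLabel lam) E ≤ u ↔ ∀ c ∈ E.support, lam c ≤ u c := by
  have hle (q : Fin m × Fin n) : visscherVertexLabel lam (visscherVertex q) ≤ u ↔
      lam (Sum.inl q.1) ≤ u (Sum.inl q.1) ∧ lam (Sum.inr q.2) ≤ u (Sum.inr q.2) := by
    rw [visscherVertexLabel_visscherVertex]
    constructor
    · intro h
      have h1 := h (Sum.inl q.1)
      have h2 := h (Sum.inr q.2)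
      simp at h1 h2
      exact ⟨h1, h2⟩
    · rintro ⟨h1, h2⟩ (i | j)
      · by_cases h : i = q.1
        · subst h; simpa using h1
        · simp [Ne.symm h]
      · by_cases h : j = q.2
        · subst h; simpa using h2
        · simp [Ne.symm h]
  have hmem (q : Fin m × Fin n) :
      ((visscherVertex q : {v : VisscherFace m n // visscherDim v = 0}) : VisscherFace m n) ≤ E ↔
        q.1 ∈ E.1.1 ∧ q.2 ∈ E.1.2 := by
    rw [VisscherFace.le_iff]
    exact and_congr Finset.singleton_subset_iff Finset.singleton_subset_iff
  rw [cellLabel_le_iff]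
  constructor
  · intro h
    have h' (i) (hi : i ∈ E.1.1) (j) (hj : j ∈ E.1.2) :=
      (hle (i, j)).1 (h _ ((hmem (i, j)).2 ⟨hi, hj⟩))
    rintro (i | j) hc
    · have hi := VisscherFace.inl_mem_support.1 hc
      obtain ⟨j, hj⟩ := VisscherFace.fst_nonempty_iff_snd.1 ⟨i, hi⟩
      exact (h' i hi j hj).1
    · have hj := VisscherFace.inr_mem_support.1 hc
      obtain ⟨i, hi⟩ := VisscherFace.fst_nonempty_iff_snd.2 ⟨j, hj⟩
      exact (h' i hi j hj).2
  · intro h v hv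
    obtain ⟨q, rfl⟩ := visscherVertex_bijective.2 v
    obtain ⟨hi, hj⟩ := (hmem q).1 hv
    exact (hle q).2 ⟨h _ (VisscherFace.inl_mem_support.2 hi),
      h _ (VisscherFace.inr_mem_support.2 hj)⟩

theorem cellLabel_visscher_ne (hlam : ∀ v, 1 ≤ lam v) {E E' : VisscherFace m n} (hlt : E' < E) :
    cellLabel visscherDim (visscherVertexLabel lam) E ≠
      cellLabel visscherDim (visscherVertexLabel lam) E' := by
  obtain ⟨c, hc, hc'⟩ := Finset.not_subset.1 (mt VisscherFace.le_iff_support.2 hlt.not_ge)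
  -- The monomial with the exponents `lam`, but without the variable `c`.
  let u : (Fin m ⊕ Fin n) →₀ ℕ :=
    Finsupp.equivFunOnFinite.symm fun v => if v = c then 0 else lam v
  intro h
  have h1 : cellLabel visscherDim (visscherVertexLabel lam) E' ≤ u := by
    refine cellLabel_visscher_le_iff.2 fun v hv => ?_
    have : v ≠ c := fun h => hc' (h ▸ hv)
    simp [u, this]
  rw [← h, cellLabel_visscher_le_iff] at h1
  have h2 := h1 c hc
  simp only [u, Finsupp.equivFunOnFinite_symm_apply_apply, if_true] at h2
  exact absurd (hlam c) (by omega)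

theorem weightedEdgeIdeal_completeBipartiteGraph (k : Type*) [Field k] :
    weightedEdgeIdeal k (completeBipartiteGraph (Fin m) (Fin n)) lam =
      Ideal.span (Set.range fun v : {v : VisscherFace m n // visscherDim v = 0} =>
        MvPolynomial.monomial (visscherVertexLabel lam v) (1 : k)) := by
  have hmon (i : Fin m) (j : Fin n) :
      MvPolynomial.monomial (visscherVertexLabel lam (visscherVertex (i, j))) (1 : k) =
        MvPolynomial.X (Sum.inl i) ^ lam (Sum.inl i) *
          MvPolynomial.X (Sum.inr j) ^ lam (Sum.inr j) := by
    rw [visscherVertexLabel_visscherVertex, MvPolynomial.X_pow_eq_monomial,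
      MvPolynomial.X_pow_eq_monomial, MvPolynomial.monomial_mul, one_mul]
  rw [weightedEdgeIdeal]
  congr 1
  ext p
  constructor
  · rintro ⟨v | v, w | w, hvw, rfl⟩
    · simp at hvw
    · exact ⟨visscherVertex (v, w), hmon v w⟩
    · exact ⟨visscherVertex (w, v), (hmon w v).trans (mul_comm _ _)⟩
    · simp at hvw
  · rintro ⟨v, rfl⟩
    obtain ⟨⟨i, j⟩, rfl⟩ := visscherVertex_bijective.2 v
    exact ⟨Sum.inl i, Sum.inr j, by simp, hmon i j⟩

end VisscherLabels

/-! ### The minimal free resolution -/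

theorem proposition2p9 {k : Type*} [Field k] (m n : ℕ) (hm : 1 ≤ m) (hn : 1 ≤ n)
    (lam : Fin m ⊕ Fin n → ℕ) (hlam : ∀ v, 1 ≤ lam v) :
    IsFiniteRegularCellComplex (visscherDim (m := m) (n := n)) visscherCell ∧
    IsIncidenceFunction (visscherDim (m := m) (n := n)) visscherSign ∧
    ∀ ε : VisscherFace m n → VisscherFace m n → ℤ, IsIncidenceFunction visscherDim ε →
      IsMinimalFreeResolution
        (MvPolynomial.idealOfVars (Fin m ⊕ Fin n) k)
        (CellularModule (MvPolynomial (Fin m ⊕ Fin n) k) (visscherDim (m := m) (n := n)))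
        (cellularDifferential k visscherDim ε (visscherVertexLabel lam))
        (cellularAugmentation visscherDim
          (weightedEdgeIdeal k (completeBipartiteGraph (Fin m) (Fin n)) lam)) := by
  have hcell := isFiniteRegularCellComplex_visscher hm hn
  refine ⟨hcell, isIncidenceFunction_visscherSign, fun ε hinc => ?_⟩
  have hε (E E' : VisscherFace m n) (hd : visscherDim E' = visscherDim E - 1) (h : ε E E' ≠ 0) :
      E' ≤ E := (hinc.ne_zero_iff E E' hd).1 h
  refine ⟨fun i => inferInstance, fun i => inferInstance,
    surjective_cellularAugmentation hcell.existsUnique_empty.exists _,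
    cellularDifferential_exact_augmentation hinc hcell.dim_lt hcell.existsUnique_empty
      (weightedEdgeIdeal_completeBipartiteGraph k),
    cellularDifferential_exact hε (cellBoundary_cellBoundary_visscher hinc) fun u d g hg hg0 => ?_,
    range_cellularDifferential_le hε fun E E' hd hle => cellLabel_visscher_ne hlam
      (lt_of_le_of_ne hle fun h => by rw [h] at hd; omega)⟩
  -- The cells with label dividing `x ^ u` are those on the vertices `c` with `lam c ≤ u c`.
  obtain ⟨w, hw, hwg⟩ := exists_cellBoundary_eq_visscher hinc {c | lam c ≤ u c}
    (fun E hE => ⟨(hg E hE).1, cellLabel_visscher_le_iff.1 (hg E hE).2⟩) hg0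
  exact ⟨w, fun E hE => cellLabel_visscher_le_iff.2 (hw E hE), hwg⟩
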